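/- Let $n\ge 1$. Consider the $n\times n$ square grid of vertices $(x,y)$, $1\le x,y\le n$ (columns $x$ from left to right, rows $y$ from bottom to top). \emph{20V model.} Every vertex is incident to six edges: horizontal edges $(x,y)$–$(x+1,y)$, vertical edges $(x,y)$–$(x,y+1)$ and diagonal edges $(x,y+1)$–$(x+1,y)$; the domain consists of all edges with at least one end point in the grid. A configuration is an orientation of these edges such that each grid vertex has three incoming and three outgoing edges (ice rule), subject to the following boundary conditions: horizontal boundary edges point towards the grid and vertical boundary edges point away from it; apart from the two corner edges, the diagonal boundary edges on the West boundary ($(0,y+1)$–$(1,y)$, $1\le y\le n-1$) and on the South boundary ($(x,1)$–$(x+1,0)$, $1\le x\le n-1$) are oriented from Northwest to Southeast, and those on the East boundary ($(n,y+1)$–$(n+1,y)$) and on the North boundary ($(x,n+1)$–$(x+1,n)$) from Southeast to Northwest; the corner edges $(0,n+1)$–$(1,n)$ and $(n,1)$–$(n+1,0)$ are both oriented from Northwest to Southeast for type BC1 and both from Southeast to Northwest for type BC2. \emph{6V model.} The same without diagonal edges: each vertex has four edges, two incoming and two outgoing, horizontal boundary edges point towards the grid and vertical ones away from it. \emph{Osculating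 paths.} The edges oriented from West to East, North to South, or Northwest to Southeast are path steps; at each vertex the incoming steps are joined to the outgoing ones in the unique non-crossing way. The uppermost path starts with the edge $(0,n+1)\to(1,n)$ for BC1, and with $(0,n)\to(1,n)$ for BC2 and for the 6V model. Let $\ell\in\{1,\dots,n\}$ be the row in which the uppermost path first hits the last column $x=n$. Let $Z^{BC1}_\ell$ and $Z^{BC2}_\ell$ be the numbers of 20V configurations of types BC1 and BC2 with given $\ell$. Let $Z^{6V}_\ell$ be the sum over the 6V configurations with given $\ell$ of the product of the vertex weights $(a,b,c)=(1,\sqrt2,1)$, where a vertex visited by no path or by two paths has weight $a$, a vertex traversed horizontally or vertically by a single path has weight $b$, and a vertex at which a single path turns has weight $c$. Put $$\hat Z^{BC1}(\tau)=\sum_{\ell=1}^n Z^{BC1}_\ell\tau^{\ell-1},\qquad \hat Z^{BC2}(\tau)=\sum_{\ell=1}^n Z^{BC2}_\ell\tau^{\ell-1},\qquad \hat Z^{6V}_{[1,\sqrt2,1]}(\sigma)=\sum_{\ell=1}^n Z^{6V}_\ell\sigma^{\ell-1}.$$ Then, for every $\tau\in\mathbb C$, $$\hat Z^{BC2}(\tau)=\hat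 Z^{6V}_{[1,\sqrt2,1]}\left(\frac{1+\tau}{2}\right),$$ and, for every $\tau\in\mathbb C\setminus\{0\}$, $$\hat Z^{BC2}(\tau)=\hat Z^{BC1}(0)+\frac{1+\tau}{2\tau}\left(\hat Z^{BC1}(\tau)-\hat Z^{BC1}(0)\right).$$ Moreover, coefficient-wise, $Z^{BC1}_1=Z^{6V}_1$, $$Z^{BC1}_\ell=\sum_{m=\ell}^n\binom{m-2}{\ell-2}\frac1{2^{m-2}}Z^{6V}_m\quad(2\le\ell\le n),\qquad Z^{BC2}_\ell=\sum_{m=\ell}^n\binom{m-1}{\ell-1}\frac1{2^{m-1}}Z^{6V}_m\quad(1\le\ell\le n).$$ -/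

import Mathlib

/-!
  The twenty-vertex (20V) and six-vertex (6V) models on an `n × n` square with domain wall
  boundary conditions, and their refinement by the uppermost osculating path.

  Points of the plane are pairs `(x, y) : ℤ × ℤ`; columns are numbered by `x = 1, …, n` from left
  to right and rows by `y = 1, …, n` from bottom to top.
-/

namespace TwentyVertex

open Finset

/-- The kinds of lattice edges. -/
inductive Step : Type
  | horizontal
  | vertical
  | diagonal
  deriving DecidableEq

/-- The displacement along an edge in its natural orientation: West to East, North to South,
Northwest to Southeast. -/
def Step.vec : Step → ℤ × ℤ
  | .horizontal => (1, 0)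
  | .vertical => (0, -1)
  | .diagonal => (1, -1)

/-- A lattice edge: its kind and its starting point for the natural orientation. -/
abbrev Edge : Type := Step × (ℤ × ℤ)

/-- Starting point of an edge for the natural orientation. -/
def tail (e : Edge) : ℤ × ℤ := e.2

/-- End point of an edge for the natural orientation. -/
def head (e : Edge) : ℤ × ℤ := e.2 + e.1.vec

/-- The `n × n` vertices `(x, y)`, `1 ≤ x, y ≤ n`. -/
noncomputable def grid (n : ℕ) : Finset (ℤ × ℤ) := Icc 1 (n : ℤ) ×ˢ Icc 1 (n : ℤ)

/-- All inner and boundary edges: the edges with kind in `L` that have at least one end point in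
the grid. For `L = squareSteps` this is the square lattice domain (6V model), for
`L = triangularSteps` the triangular lattice domain, corner edges included (20V model). -/
noncomputable def edges (L : Finset Step) (n : ℕ) : Finset Edge :=
  (L ×ˢ (Icc 0 ((n : ℤ) + 1) ×ˢ Icc 0 ((n : ℤ) + 1))).filter
    fun e => tail e ∈ grid n ∨ head e ∈ grid n

/-- The edges of the square lattice: each vertex has four neighbours. -/
def squareSteps : Finset Step := {.horizontal, .vertical}

/-- The edges of the (straightened) triangular lattice: each vertex has six neighbours. -/
def triangularSteps : Finset Step := {.horizontal, .vertical, .diagonal}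

/-! An orientation of all edges of the domain is encoded by the set `S` of those edges whose actual
orientation is the natural one; these are the edges covered by path steps. -/

/-- Edges that point towards the vertex `v`. -/
noncomputable def pointingIn (L : Finset Step) (n : ℕ) (S : Finset Edge) (v : ℤ × ℤ) : Finset Edge :=
  (edges L n).filter fun e => (e ∈ S ∧ head e = v) ∨ (e ∉ S ∧ tail e = v)

/-- Edges that point away from the vertex `v`. -/
noncomputable def pointingOut (L : Finset Step) (n : ℕ) (S : Finset Edge) (v : ℤ × ℤ) : Finset Edge :=
  (edges L n).filter fun e => (e ∈ S ∧ tail e = v) ∨ (e ∉ S ∧ head e = v)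

/-- The ice rule: at each vertex half of the incident edges point in and half point out (two and
two on the square lattice, three and three on the triangular lattice). -/
def IceRule (L : Finset Step) (n : ℕ) (S : Finset Edge) : Prop :=
  ∀ v ∈ grid n, (pointingIn L n S v).card = L.card ∧ (pointingOut L n S v).card = L.card

/-- Domain wall conditions for horizontal and vertical boundary edges: horizontal ones point
towards the grid, vertical ones point away from it. -/
def SquareDWBC (n : ℕ) (S : Finset Edge) : Prop :=
  (∀ y ∈ Icc 1 (n : ℤ), (Step.horizontal, (0, y)) ∈ S) ∧
  (∀ x ∈ Icc 1 (n : ℤ), (Step.vertical, (x, 1)) ∈ S) ∧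
  (∀ y ∈ Icc 1 (n : ℤ), (Step.horizontal, ((n : ℤ), y)) ∉ S) ∧
  (∀ x ∈ Icc 1 (n : ℤ), (Step.vertical, (x, (n : ℤ) + 1)) ∉ S)

/-- Conditions for the diagonal boundary edges other than the two corner edges: those on the
West boundary, from `(0, y + 1)` to `(1, y)`, and on the South boundary, from `(x, 1)` to
`(x + 1, 0)`, have the natural orientation; those on the East boundary, between `(n, y + 1)` and
`(n + 1, y)`, and on the North boundary, between `(x, n + 1)` and `(x + 1, n)`, the opposite one. -/
def DiagonalDWBC (n : ℕ) (S : Finset Edge) : Prop :=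
  (∀ y ∈ Icc 1 ((n : ℤ) - 1), (Step.diagonal, (0, y + 1)) ∈ S) ∧
  (∀ x ∈ Icc 1 ((n : ℤ) - 1), (Step.diagonal, (x, 1)) ∈ S) ∧
  (∀ y ∈ Icc 1 ((n : ℤ) - 1), (Step.diagonal, ((n : ℤ), y + 1)) ∉ S) ∧
  (∀ x ∈ Icc 1 ((n : ℤ) - 1), (Step.diagonal, (x, (n : ℤ) + 1)) ∉ S)

/-- The two types of domain wall boundary conditions of the 20V model. -/
inductive DWBCType : Type
  | bc1
  | bc2

/-- The upper-left corner edge, between `(0, n + 1)` and `(1, n)`. -/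
def upperLeftCorner (n : ℕ) : Edge := (Step.diagonal, (0, (n : ℤ) + 1))

/-- The lower-right corner edge, between `(n, 1)` and `(n + 1, 0)`. -/
def lowerRightCorner (n : ℕ) : Edge := (Step.diagonal, ((n : ℤ), 1))

/-- Both corner edges have the natural orientation for DWBC1, the opposite one for DWBC2. -/
def CornerDWBC (n : ℕ) (S : Finset Edge) : DWBCType → Prop
  | .bc1 => upperLeftCorner n ∈ S ∧ lowerRightCorner n ∈ S
  | .bc2 => upperLeftCorner n ∉ S ∧ lowerRightCorner n ∉ S

/-- The configurations of the 20V model with DWBC1 or DWBC2 on the `n × n` grid. -/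
noncomputable def configs20V (t : DWBCType) (n : ℕ) : Finset (Finset Edge) :=
  open Classical in
  (edges triangularSteps n).powerset.filter fun S =>
    IceRule triangularSteps n S ∧ SquareDWBC n S ∧ DiagonalDWBC n S ∧ CornerDWBC n S t

/-- The configurations of the 6V model with DWBC on the `n × n` grid. -/
noncomputable def configs6V (n : ℕ) : Finset (Finset Edge) :=
  open Classical in
  (edges squareSteps n).powerset.filter fun S => IceRule squareSteps n S ∧ SquareDWBC n S

/-! Osculating paths. At each vertex the incoming path steps, listed from the uppermost one down
(from N, from NW, from W), are joined in this order to the outgoing ones, listed from the uppermost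
one down (to E, to SE, to S); this is the unique way of joining them without crossings. -/

/-- Position of an incoming step in the order N, NW, W. -/
def Step.inPos : Step → ℕ
  | .vertical => 0
  | .diagonal => 1
  | .horizontal => 2

/-- Position of an outgoing step in the order E, SE, S. -/
def Step.outPos : Step → ℕ
  | .horizontal => 0
  | .diagonal => 1
  | .vertical => 2

/-- Number of path steps that enter the end point of `e` above `e`. -/
def inRank (S : Finset Edge) (e : Edge) : ℕ :=
  (S.filter fun f => head f = head e ∧ f.1.inPos < e.1.inPos).card

/-- Number of path steps that leave the starting point of `e` above `e`. -/
def outRank (S : Finset Edge) (e : Edge) : ℕ :=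
  (S.filter fun f => tail f = tail e ∧ f.1.outPos < e.1.outPos).card

/-- `e` and `e'` are consecutive steps of one of the osculating paths of `S`. -/
def Follows (S : Finset Edge) (e e' : Edge) : Prop :=
  e ∈ S ∧ e' ∈ S ∧ tail e' = head e ∧ inRank S e = outRank S e'

/-- The path of `S` that starts with the step `e₀` first hits the vertical line `x = n` at the
vertex `(n, ℓ)`: one of its steps leads to `(n, ℓ)` from a point that is not on this line.
(Along a path `x` never decreases, so there is at most one such step.) -/
def FirstHitsLastColumnAt (n : ℕ) (S : Finset Edge) (e₀ : Edge) (ℓ : ℕ) : Prop :=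
  ∃ e : Edge, Relation.ReflTransGen (Follows S) e₀ e ∧
    (tail e).1 < (n : ℤ) ∧ head e = ((n : ℤ), (ℓ : ℤ))

/-- The horizontal edge from `(0, n)` to `(1, n)`. -/
def upperWestEdge (n : ℕ) : Edge := (Step.horizontal, (0, (n : ℤ)))

/-- The first step of the uppermost path of a 20V configuration: the upper-left corner edge
for DWBC1, the highest horizontal West boundary edge for DWBC2. -/
def topStart (n : ℕ) : DWBCType → Edge
  | .bc1 => upperLeftCorner n
  | .bc2 => upperWestEdge n

/-- The number of 20V configurations whose uppermost path first hits the last column in row `ℓ`. -/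
noncomputable def Z20V (t : DWBCType) (n ℓ : ℕ) : ℕ :=
  open Classical in
  ((configs20V t n).filter fun S => FirstHitsLastColumnAt n S (topStart n t) ℓ).card

/-- The 6V weight of the vertex `v`: `a` if it is visited by no path or by two paths, `b` if a
single path traverses it horizontally or vertically, `c` if a single path turns at it. By the ice
rule the occupation of the edges to the West, North and East of `v` determines the case. -/
noncomputable def weight6V (a b c : ℝ) (S : Finset Edge) (v : ℤ × ℤ) : ℝ :=
  if ((Step.horizontal, v - (1, 0)) ∈ S ↔ (Step.vertical, v + (0, 1)) ∈ S) then a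
  else if ((Step.horizontal, v - (1, 0)) ∈ S ↔ (Step.horizontal, v) ∈ S) then b
  else c

/-- The 6V partition function with DWBC and weights `(a, b, c)`, restricted to the configurations
whose uppermost path first hits the last column in row `ℓ`. -/
noncomputable def Z6V (a b c : ℝ) (n ℓ : ℕ) : ℝ :=
  open Classical in
  ∑ S ∈ (configs6V n).filter fun S => FirstHitsLastColumnAt n S (upperWestEdge n) ℓ,
    ∏ v ∈ grid n, weight6V a b c S v

/-- The generating polynomial `∑_{ℓ=1}^n Z_ℓ X^{ℓ-1}` of refined numbers `Z_1, …, Z_n`. -/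
noncomputable def genPoly (n : ℕ) (Z : ℕ → ℝ) : Polynomial ℝ :=
  ∑ ℓ ∈ Icc 1 n, Polynomial.C (Z ℓ) * Polynomial.X ^ (ℓ - 1)

/-- The generating polynomial of the refined 20V numbers. -/
noncomputable def genPoly20V (t : DWBCType) (n : ℕ) : Polynomial ℝ :=
  genPoly n fun ℓ => (Z20V t n ℓ : ℝ)

/-- The generating polynomial of the refined 6V partition functions. -/
noncomputable def genPoly6V (a b c : ℝ) (n : ℕ) : Polynomial ℝ :=
  genPoly n fun ℓ => Z6V a b c n ℓ

end TwentyVertex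

/-! A 20V vertex can be resolved into three six-vertex crossings, of a horizontal, a vertical and a
diagonal line. With the weights `crossHV`, `crossHD`, `crossVD` at parameter 1, every vertex that
obeys the ice rule gets weight 1 (`vertex20_one`), so counting 20V configurations means evaluating a
partition function of crossing lines. The weights satisfy the Yang-Baxter equation for every
positive parameter of the vertical line (`vertex20_eq`). The last column is given a free parameter
t, the other columns the parameter 1.

The diagonal lines run along antidiagonals. A line whose ends carry path steps is moved Southwest,
through all crossings of horizontal and vertical lines, until it meets only boundary edges that
carry path steps. A line with empty ends is moved Northeast towards the empty boundary. There all
states agree, every crossing has weight 1, and the line drops out (`trianglePF_vertexThenLine`). The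
two corner edges belong to one line, which is of the first kind for BC1 and of the second for BC2.
What remains is the 6V model with weights (1, √2, 1), modified in the last column
(`sum_vertex20_eq_sum_vertex6`).

It remains to read off the dependence on t. The uppermost path enters the last column in the highest
row ℓ in which any path does, and the vertical edges of that column are occupied exactly up to row ℓ
(`occ_vertical_last`). Hence the last column contributes, up to the common factor `turnWeight t`,
t^(ℓ-1) for BC2, t^(ℓ-2)(1+t)/2 for BC1 with ℓ ≥ 2 (and 1 for ℓ = 1), and ((1+t)/2)^(ℓ-1) relative
to the homogeneous weights for 6V. Equating the sums (`sum_Z20V_eq_sum_Z6V`) gives polynomial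
identities in t. For BC1 the value at t = -1 isolates ℓ = 1, and the factor (1+t)/2 cancels from the
rest; the coefficient formulas are binomial expansions. -/

namespace TwentyVertex

open Finset

/-! ### Ordered products in a noncommutative monoid, and transfer matrices -/

section OrderedProducts

/-- The product of a finite sequence in a monoid, in the order of the indices. -/
def orderedProd {M : Type*} [Monoid M] {m : ℕ} (f : Fin m → M) : M := (List.ofFn f).prod

theorem orderedProd_zero {M : Type*} [Monoid M] (f : Fin 0 → M) : orderedProd f = 1 := by
  simp [orderedProd]

theorem orderedProd_succ {M : Type*} [Monoid M] {m : ℕ} (f : Fin (m + 1) → M) :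
    orderedProd f = f 0 * orderedProd fun i : Fin m => f i.succ := by
  simp [orderedProd, List.ofFn_succ]

theorem orderedProd_succ_last {M : Type*} [Monoid M] {m : ℕ} (f : Fin (m + 1) → M) :
    orderedProd f = (orderedProd fun i : Fin m => f i.castSucc) * f (Fin.last m) := by
  simp only [orderedProd, List.ofFn_succ', List.concat_eq_append, List.prod_append,
    List.prod_singleton]

/-- Rebracketing of a product of pairs. -/
theorem orderedProd_mul_shift {M : Type*} [Monoid M] {m : ℕ} (a b : Fin (m + 1) → M) :
    (orderedProd fun i => a i * b i) =
      a 0 * (orderedProd fun i : Fin m => b i.castSucc * a i.succ) * b (Fin.last m) := by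
  induction m with
  | zero => simp [orderedProd_succ, orderedProd_zero]
  | succ m ih =>
    rw [orderedProd_succ_last, ih (fun i => a i.castSucc) (fun i => b i.castSucc),
      orderedProd_succ_last (m := m)]
    simp only [mul_assoc, Fin.succ_last, Fin.castSucc_zero, Fin.succ_castSucc]

theorem sum_fin_cons {α R : Type*} [Fintype α] [AddCommMonoid R] {m : ℕ}
    (f : (Fin (m + 1) → α) → R) :
    ∑ x, f x = ∑ a : α, ∑ x : Fin m → α, f (Fin.cons a x) := by
  rw [← Fintype.sum_prod_type']
  exact (Fintype.sum_equiv (Fin.consEquiv fun _ : Fin (m + 1) => α) _ _ fun _ => rfl).symm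

theorem sum_fin_snoc {α R : Type*} [Fintype α] [AddCommMonoid R] {m : ℕ}
    (f : (Fin (m + 1) → α) → R) :
    ∑ x, f x = ∑ a : α, ∑ x : Fin m → α, f (Fin.snoc x a) := by
  rw [← Fintype.sum_prod_type']
  exact (Fintype.sum_equiv (Fin.snocEquiv fun _ : Fin (m + 1) => α) _ _ fun _ => rfl).symm

/-- Distributivity that keeps the order of the factors, since transfer matrices do not commute. -/
theorem sum_orderedProd {α R : Type*} [Fintype α] [Semiring R] {m : ℕ} (f : Fin m → α → R) :
    ∑ x : Fin m → α, orderedProd (fun i => f i (x i)) = orderedProd fun i => ∑ a, f i a := by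
  induction m with
  | zero => simp [orderedProd_zero]
  | succ m ih =>
    rw [sum_fin_cons]
    simp only [orderedProd_succ, Fin.cons_zero, Fin.cons_succ, ← mul_sum, ih, ← sum_mul]

theorem sum_sum_orderedProd {α R : Type*} [Fintype α] [Semiring R] {m : ℕ}
    (f : Fin m → α → α → R) :
    ∑ x : Fin m → α, ∑ y : Fin m → α, orderedProd (fun i => f i (x i) (y i)) =
      orderedProd fun i => ∑ a, ∑ b, f i a b := by
  rw [← sum_orderedProd fun i a => ∑ b, f i a b]
  exact sum_congr rfl fun x _ => sum_orderedProd fun i b => f i (x i) b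

theorem orderedProd_smul {R M : Type*} [CommSemiring R] [Semiring M] [Algebra R M] {m : ℕ}
    (c : Fin m → R) (f : Fin m → M) :
    (orderedProd fun i => c i • f i) = (∏ i, c i) • orderedProd f := by
  induction m with
  | zero => simp [orderedProd_zero]
  | succ m ih =>
    rw [orderedProd_succ, ih, Fin.prod_univ_succ, orderedProd_succ]
    rw [smul_mul_smul_comm]

/-- An entry of an ordered product of matrices is a sum over sequences of indices. -/
theorem orderedProd_matrix_apply {α R : Type*} [Fintype α] [DecidableEq α] [CommSemiring R] {m : ℕ}
    (f : Fin (m + 1) → Matrix α α R) (a b : α) :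
    orderedProd f a b = ∑ d : Fin m → α, ∏ i : Fin (m + 1),
      f i ((Fin.cons a d : Fin (m + 1) → α) i) ((Fin.snoc d b : Fin (m + 1) → α) i) := by
  induction m generalizing a with
  | zero => simp [orderedProd_succ, orderedProd_zero, Fin.snoc]
  | succ m ih =>
    rw [orderedProd_succ, Matrix.mul_apply, sum_fin_cons]
    refine sum_congr rfl fun c _ => ?_
    rw [ih, mul_sum]
    refine sum_congr rfl fun d _ => ?_
    rw [Fin.prod_univ_succ (n := m + 1)]
    congr 1
    refine prod_congr rfl fun i _ => ?_
    rw [← Fin.cons_snoc_eq_snoc_cons]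
    simp

end OrderedProducts

theorem sum_sum_comm_sum_sum {α β γ δ R : Type*} [Fintype α] [Fintype β] [Fintype γ] [Fintype δ]
    [AddCommMonoid R] (f : α → β → γ → δ → R) :
    ∑ a, ∑ b, ∑ c, ∑ d, f a b c d = ∑ c, ∑ d, ∑ a, ∑ b, f a b c d := by
  simpa only [Fintype.sum_prod_type] using
    sum_comm (s := univ) (t := univ) (f := fun (x : α × β) (y : γ × δ) => f x.1 x.2 y.1 y.2)

/-! ### Triangular networks: expelling diagonal lines by the Yang-Baxter equation -/

section Network

variable (G : ℕ → ℕ → Bool → Bool → Bool → Bool → Matrix Bool Bool ℝ) (β : Bool)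

/-- The partition function of a triangle of `k` antidiagonal layers. Layer `j` has `j` vertices;
`G j i l r p q` is the transfer matrix of its `i`-th vertex along the antidiagonal, where `l, r` are
the inner edges and `p, q` the outer ones. Boundary edges are in the state `β`. -/
noncomputable def trianglePF : (k : ℕ) → (Fin k → Bool) → (Fin k → Bool) → ℝ
  | 0, _, _ => 1
  | k + 1, p, q => ∑ p' : Fin k → Bool, ∑ q' : Fin k → Bool, trianglePF k p' q' *
      orderedProd (fun i : Fin (k + 1) => G (k + 1) i ((Fin.cons β q' : Fin (k + 1) → Bool) i)
        ((Fin.snoc p' β : Fin (k + 1) → Bool) i) (p i) (q i)) β β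

theorem trianglePF_congr {G G' : ℕ → ℕ → Bool → Bool → Bool → Bool → Matrix Bool Bool ℝ}
    (h : ∀ k i, i < k → G k i = G' k i) (k : ℕ) (p q : Fin k → Bool) :
    trianglePF G β k p q = trianglePF G' β k p q := by
  induction k with
  | zero => rfl
  | succ k ih =>
    simp only [trianglePF, ih]
    refine sum_congr rfl fun p' _ => sum_congr rfl fun q' _ => ?_
    congr 2
    simp only [h (k + 1) _ (Fin.is_lt _)]

variable (U : ℕ → ℕ → Bool → Bool → Bool → Bool → ℝ)
  (A B : ℕ → Bool → Bool → Matrix Bool Bool ℝ)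

/-- A vertex followed by a diagonal line that crosses its two outer edges. -/
noncomputable def vertexThenLine (k i : ℕ) (l r p q : Bool) : Matrix Bool Bool ℝ :=
  ∑ p', ∑ q', U k i l r p' q' • (B i p' p * A (k - 1 - i) q' q)

/-- A diagonal line that crosses the outer edges of the `k`-th layer. -/
noncomputable def lineTransfer (k : ℕ) (p' q' p q : Fin k → Bool) : Matrix Bool Bool ℝ :=
  orderedProd fun i : Fin k => B i (p' i) (p i) * A (k - 1 - i) (q' i) (q i)

/-- Vertices without a diagonal line. -/
noncomputable def bareVertex (k i : ℕ) (l r p q : Bool) : Matrix Bool Bool ℝ := U k i l r p q • 1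

theorem trianglePF_bareVertex_succ (k : ℕ) (p q : Fin (k + 1) → Bool) :
    trianglePF (bareVertex U) β (k + 1) p q = ∑ p' : Fin k → Bool, ∑ q' : Fin k → Bool,
      trianglePF (bareVertex U) β k p' q' * ∏ i : Fin (k + 1), U (k + 1) i
        ((Fin.cons β q' : Fin (k + 1) → Bool) i) ((Fin.snoc p' β : Fin (k + 1) → Bool) i)
        (p i) (q i) := by
  simp only [trianglePF, bareVertex]
  refine sum_congr rfl fun p' _ => sum_congr rfl fun q' _ => ?_
  rw [orderedProd_smul (f := fun _ => (1 : Matrix Bool Bool ℝ))]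
  have : orderedProd (fun _ : Fin (k + 1) => (1 : Matrix Bool Bool ℝ)) = 1 := by
    simp [orderedProd]
  simp [this]

/-- Adding a layer together with its diagonal line is adding the layer and then the line. -/
theorem sum_vertexThenLine (k : ℕ) (p q : Fin (k + 1) → Bool) :
    ∑ p' : Fin k → Bool, ∑ q' : Fin k → Bool, trianglePF (bareVertex U) β k p' q' *
      orderedProd (fun i : Fin (k + 1) => vertexThenLine U A B (k + 1) i
        ((Fin.cons β q' : Fin (k + 1) → Bool) i)
        ((Fin.snoc p' β : Fin (k + 1) → Bool) i) (p i) (q i)) β β =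
    ∑ p' : Fin (k + 1) → Bool, ∑ q' : Fin (k + 1) → Bool,
      trianglePF (bareVertex U) β (k + 1) p' q' * lineTransfer A B (k + 1) p' q' p q β β := by
  simp only [trianglePF_bareVertex_succ, sum_mul]
  have key : ∀ l r : Fin (k + 1) → Bool,
      orderedProd (fun i : Fin (k + 1) => vertexThenLine U A B (k + 1) i (l i) (r i) (p i) (q i)) β β
        = ∑ p' : Fin (k + 1) → Bool, ∑ q' : Fin (k + 1) → Bool,
          (∏ i : Fin (k + 1), U (k + 1) i (l i) (r i) (p' i) (q' i)) *
            lineTransfer A B (k + 1) p' q' p q β β := by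
    intro l r
    simp only [vertexThenLine]
    rw [← sum_sum_orderedProd (fun (i : Fin (k + 1)) a b => U (k + 1) i (l i) (r i) a b •
      (B i a (p i) * A (k + 1 - 1 - i) b (q i)))]
    simp only [orderedProd_smul, lineTransfer, Matrix.sum_apply, Matrix.smul_apply, smul_eq_mul]
  simp only [key, mul_sum]
  rw [sum_sum_comm_sum_sum]
  simp only [mul_assoc]

/-- A line in the state `β` that meets an edge in the state `β` passes it without effect. -/
structure Frozen : Prop where
  left : ∀ j l' d, A j β l' β d = if l' = β ∧ d = β then 1 else 0
  right : ∀ i r' d, B i β r' d β = if r' = β ∧ d = β then 1 else 0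

/-- On the inner side of a layer the line meets one more pair of edges than on the outer side of the
preceding layer: the first and the last edge lie on the boundary. Freezing removes these two
crossings, and rebracketing turns the remaining pairs A, B into pairs B, A, which is the line just
outside the preceding layer. -/
theorem lineTransfer_frozen (h : Frozen β A B) (k : ℕ) (p' q' : Fin k → Bool)
    (l r : Fin (k + 1) → Bool) :
    orderedProd (fun i : Fin (k + 1) => A (k - i) ((Fin.cons β q' : Fin (k + 1) → Bool) i) (l i) *
      B i ((Fin.snoc p' β : Fin (k + 1) → Bool) i) (r i)) β β =
    if l 0 = β ∧ r (Fin.last k) = β then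
      lineTransfer A B k p' q' (fun i => r i.castSucc) (fun i => l i.succ) β β else 0 := by
  rw [orderedProd_mul_shift (fun i : Fin (k + 1) => A (k - i) _ (l i)) (fun i => B i _ (r i))]
  -- The index of `A` names a line, not a position: k - (i + 1) = (k - 1) - i, so the line that
  -- leaves vertex i of layer k is the one that enters vertex i + 1 of layer k + 1.
  have : (orderedProd fun i : Fin k =>
      B i.castSucc ((Fin.snoc p' β : Fin (k + 1) → Bool) i.castSucc) (r i.castSucc) *
      A (k - i.succ) ((Fin.cons β q' : Fin (k + 1) → Bool) i.succ) (l i.succ)) =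
      lineTransfer A B k p' q' (fun i => r i.castSucc) (fun i => l i.succ) := by
    simp [lineTransfer, Nat.sub_sub, add_comm]
  rw [this]
  simp only [Matrix.mul_apply, Fin.cons_zero, Fin.snoc_last, h.left, h.right]
  by_cases hl : l 0 = β <;> by_cases hr : r (Fin.last k) = β <;> simp [hl, hr]

/-- The Yang-Baxter equation, applied at every vertex of the layer, moves the line from the outer to
the inner side of layer k + 1. There it surrounds the triangle of k layers, from which `ih` removes
it. -/
theorem sum_vertexThenLine_eq_bare (h : Frozen β A B)
    (ybe : ∀ k i, i < k → ∀ l r p q, vertexThenLine U A B k i l r p q =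
      ∑ l', ∑ r', U k i l' r' p q • (A (k - 1 - i) l l' * B i r r'))
    (k : ℕ) (ih : ∀ p q, ∑ p' : Fin k → Bool, ∑ q' : Fin k → Bool,
      trianglePF (bareVertex U) β k p' q' * lineTransfer A B k p' q' p q β β =
        trianglePF (bareVertex U) β k p q)
    (p q : Fin (k + 1) → Bool) :
    ∑ p' : Fin k → Bool, ∑ q' : Fin k → Bool, trianglePF (bareVertex U) β k p' q' *
      orderedProd (fun i : Fin (k + 1) => vertexThenLine U A B (k + 1) i
        ((Fin.cons β q' : Fin (k + 1) → Bool) i)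
        ((Fin.snoc p' β : Fin (k + 1) → Bool) i) (p i) (q i)) β β =
    trianglePF (bareVertex U) β (k + 1) p q := by
  have key : ∀ p' q' : Fin k → Bool,
      orderedProd (fun i : Fin (k + 1) => vertexThenLine U A B (k + 1) i
        ((Fin.cons β q' : Fin (k + 1) → Bool) i)
        ((Fin.snoc p' β : Fin (k + 1) → Bool) i) (p i) (q i)) β β =
      ∑ p'' : Fin k → Bool, ∑ q'' : Fin k → Bool,
        (∏ i : Fin (k + 1), U (k + 1) i ((Fin.cons β q'' : Fin (k + 1) → Bool) i)
          ((Fin.snoc p'' β : Fin (k + 1) → Bool) i) (p i) (q i)) *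
        lineTransfer A B k p' q' p'' q'' β β := by
    intro p' q'
    simp only [ybe (k + 1) _ (Fin.is_lt _)]
    rw [← sum_sum_orderedProd (fun (i : Fin (k + 1)) a b => U (k + 1) i a b (p i) (q i) •
      (A (k + 1 - 1 - i) ((Fin.cons β q' : Fin (k + 1) → Bool) i) a *
        B i ((Fin.snoc p' β : Fin (k + 1) → Bool) i) b))]
    simp only [orderedProd_smul, Matrix.sum_apply, Matrix.smul_apply, smul_eq_mul,
      Nat.add_sub_cancel, lineTransfer_frozen β A B h]
    -- The frozen ends force the first left state and the last right state to be β; the other states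
    -- are those between layers k and k + 1.
    rw [sum_fin_cons, sum_eq_single β, sum_comm]
    · rw [sum_fin_snoc, sum_eq_single β]
      · simp
      · intro b _ hb
        simp [hb]
      · simp
    · intro b _ hb
      simp [hb]
    · simp
  simp only [key, mul_sum]
  rw [sum_sum_comm_sum_sum, trianglePF_bareVertex_succ]
  refine sum_congr rfl fun p'' _ => sum_congr rfl fun q'' _ => ?_
  rw [← ih p'' q'', sum_mul]
  refine sum_congr rfl fun p' _ => ?_
  rw [sum_mul]
  exact sum_congr rfl fun q' _ => by ring

/-- A line around the whole triangle is pulled inwards one layer at a time until no layer is left.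
-/
theorem sum_lineTransfer (h : Frozen β A B)
    (ybe : ∀ k i, i < k → ∀ l r p q, vertexThenLine U A B k i l r p q =
      ∑ l', ∑ r', U k i l' r' p q • (A (k - 1 - i) l l' * B i r r'))
    (k : ℕ) (p q : Fin k → Bool) :
    ∑ p' : Fin k → Bool, ∑ q' : Fin k → Bool,
      trianglePF (bareVertex U) β k p' q' * lineTransfer A B k p' q' p q β β =
        trianglePF (bareVertex U) β k p q := by
  induction k with
  | zero => simp [trianglePF, lineTransfer, orderedProd_zero]
  | succ k ih => rw [← sum_vertexThenLine, sum_vertexThenLine_eq_bare β U A B h ybe k ih]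

/-- The diagonal lines can be removed from a triangle. -/
theorem trianglePF_vertexThenLine (h : Frozen β A B)
    (ybe : ∀ k i, i < k → ∀ l r p q, vertexThenLine U A B k i l r p q =
      ∑ l', ∑ r', U k i l' r' p q • (A (k - 1 - i) l l' * B i r r'))
    (k : ℕ) (p q : Fin k → Bool) :
    trianglePF (vertexThenLine U A B) β k p q = trianglePF (bareVertex U) β k p q := by
  induction k with
  | zero => rfl
  | succ k ih =>
    -- The inner layers lose their lines by induction; the line of the outermost layer then passes
    -- through a triangle that is already bare.
    rw [← sum_vertexThenLine_eq_bare β U A B h ybe k (sum_lineTransfer β U A B h ybe k), trianglePF]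
    simp only [ih]

end Network

/-! ### Crossing weights, the Yang-Baxter equation and the resulting 20V weights -/

section Weights

/-- The weight of a crossing of two lines with incoming states `i₁, i₂` and outgoing states
`o₁, o₂`: `a` if both lines are in the same state, `b` if the states pass, `c` if they are
exchanged. -/
def crossing (a b c : ℝ) (i₁ i₂ o₁ o₂ : Bool) : ℝ :=
  if i₁ = o₁ ∧ i₂ = o₂ then (if i₁ = i₂ then a else b) else if i₁ = o₂ ∧ i₂ = o₁ then c else 0

/-- The weight of type `c` of a vertical line with parameter `t`. -/
noncomputable def turnWeight (t : ℝ) : ℝ := √((1 + t ^ 2) / 2)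

/-- The crossing of a horizontal and a vertical line with the edges to the West, South, North and
East. -/
noncomputable def crossHV (t : ℝ) (w s n e : Bool) : ℝ :=
  crossing 1 ((1 + t) / √2) (turnWeight t) w n e s

/-- The crossing of a horizontal and a diagonal line, as a transfer matrix along the latter. -/
noncomputable def crossHD (w e : Bool) : Matrix Bool Bool ℝ :=
  Matrix.of fun d d' => crossing 1 (1 / √2) (1 / √2) w d e d'

/-- The crossing of a vertical and a diagonal line, as a transfer matrix along the latter. -/
noncomputable def crossVD (t : ℝ) (n s : Bool) : Matrix Bool Bool ℝ :=
  Matrix.of fun d d' => crossing 1 (√2 * t / (1 + t)) (√2 * turnWeight t / (1 + t)) n d s d'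

/-- The 20V vertex obtained from the crossings of a horizontal, a vertical and a diagonal line. -/
noncomputable def vertex20 (t : ℝ) (w s n e : Bool) : Matrix Bool Bool ℝ :=
  ∑ n', ∑ e', crossHV t w s n' e' • (crossVD t n n' * crossHD e' e)

theorem turnWeight_one : turnWeight 1 = 1 := by norm_num [turnWeight]

theorem turnWeight_sq (t : ℝ) : turnWeight t ^ 2 = (1 + t ^ 2) / 2 :=
  Real.sq_sqrt (by positivity)

theorem turnWeight_pos (t : ℝ) : 0 < turnWeight t := Real.sqrt_pos.2 (by positivity)

/-- With all three weights a equal to 1, each of the 64 boundary states gives either a trivial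
identity or a consequence of the three cubic relations. -/
theorem crossing_yang_baxter {b₁ c₁ b₂ c₂ b₃ c₃ : ℝ} (h₁ : c₁ * b₂ * b₃ + c₂ * c₃ = c₁)
    (h₂ : b₂ * c₃ + c₂ * c₁ * b₃ = c₃ * b₁) (h₃ : c₂ * b₃ + b₂ * c₁ * c₃ = b₁ * c₂)
    (w s n e d d' : Bool) :
    ∑ n', ∑ e', crossing 1 b₁ c₁ w n' e' s *
        ∑ x, crossing 1 b₃ c₃ n d n' x * crossing 1 b₂ c₂ e' x e d' =
      ∑ w', ∑ s', crossing 1 b₁ c₁ w' n e s' *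
        ∑ x, crossing 1 b₂ c₂ w d w' x * crossing 1 b₃ c₃ s' x s d' := by
  cases w <;> cases s <;> cases n <;> cases e <;> cases d <;> cases d' <;>
    simp [crossing] <;> linarith

theorem turn_relation {t : ℝ} (ht : 0 < t) :
    turnWeight t * (1 / √2) * (√2 * t / (1 + t)) + 1 / √2 * (√2 * turnWeight t / (1 + t)) =
      turnWeight t := by
  have h1 : 1 + t ≠ 0 := by positivity
  field_simp
  ring

/-- This relation determines `turnWeight`: it reduces to t + `turnWeight t` ^ 2 = (1 + t) ^ 2 / 2.
-/
theorem straight_relation {t : ℝ} (ht : 0 < t) :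
    1 / √2 * (√2 * t / (1 + t)) + 1 / √2 * turnWeight t * (√2 * turnWeight t / (1 + t)) =
      (1 + t) / √2 * (1 / √2) := by
  have h1 : 1 + t ≠ 0 := by positivity
  have h3 : √2 ^ 2 = 2 := Real.sq_sqrt (by norm_num)
  have h4 := turnWeight_sq t
  field_simp
  rw [h3, h4]
  ring

/-- The Yang-Baxter equation: the diagonal line can be moved through the crossing. -/
theorem vertex20_eq {t : ℝ} (ht : 0 < t) (w s n e : Bool) :
    vertex20 t w s n e =
      ∑ w', ∑ s', crossHV t w' s' n e • (crossHD w w' * crossVD t s' s) := by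
  have h1 : 1 + t ≠ 0 := by positivity
  ext d d'
  simp only [vertex20, crossHV, crossHD, crossVD, Matrix.sum_apply, Matrix.smul_apply,
    Matrix.mul_apply, Matrix.of_apply, smul_eq_mul]
  apply crossing_yang_baxter (turn_relation ht) _ (straight_relation ht)
  field_simp

theorem vertex20_apply (t : ℝ) (w s n e d d' : Bool) :
    vertex20 t w s n e d d' = ∑ n', ∑ e', crossHV t w s n' e' *
      ∑ x, crossVD t n n' d x * crossHD e' e x d' := by
  simp only [vertex20, Matrix.sum_apply, Matrix.smul_apply, Matrix.mul_apply, smul_eq_mul]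

/-- The reason for the choice of weights: at t = 1 each sum over the inner states of the three
crossings is built from 1, √2 · (1/√2) and 1/2, and adds up to 1 whenever the number of path steps
is conserved. -/
theorem vertex20_one (w s n e d d' : Bool) :
    vertex20 1 w s n e d d' =
      if w.toNat + n.toNat + d.toNat = e.toNat + s.toNat + d'.toNat then 1 else 0 := by
  have h3 : √2 * √2 = 2 := Real.mul_self_sqrt (by norm_num)
  have e1 : (1 + 1) / √2 = √2 := by field_simp; linarith
  have e2 : √2 * 1 / (1 + 1) = 1 / √2 := by field_simp; linarith
  have e3 : 1 / √2 * √2 = 1 := by field_simp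
  have e4 : 1 / √2 * (1 / √2) = 1 / 2 := by rw [div_mul_div_comm, h3, one_mul]
  simp only [vertex20_apply, crossHV, crossHD, crossVD, turnWeight_one, Matrix.of_apply, e1, e2]
  generalize 1 / √2 = k at *
  generalize √2 = q at *
  cases w <;> cases s <;> cases n <;> cases e <;> cases d <;> cases d' <;>
    simp [crossing] <;> linarith

/-- Each crossing conserves path steps, hence so does the composite vertex. Sums over all
configurations with the right boundary thus reduce to those that obey the ice rule. -/
theorem vertex20_eq_zero (t : ℝ) {w s n e d d' : Bool}
    (h : w.toNat + n.toNat + d.toNat ≠ e.toNat + s.toNat + d'.toNat) :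
    vertex20 t w s n e d d' = 0 := by
  simp only [vertex20_apply, crossHV, crossHD, crossVD, Matrix.of_apply]
  revert h
  cases w <;> cases s <;> cases n <;> cases e <;> cases d <;> cases d' <;>
    simp [crossing]

/-- A vertex of the last column whose eastern edges carry no path step. -/
theorem vertex20_east_empty {t : ℝ} (ht : 0 < t) {w s n d : Bool}
    (h : w.toNat + n.toNat + d.toNat = s.toNat) :
    vertex20 t w s n false d false = if n then t else if s then turnWeight t else 1 := by
  have h1 : 1 + t ≠ 0 := by positivity
  have h2 : √2 ≠ 0 := by positivity
  have e1 : (1 + t) / √2 * (√2 * t / (1 + t)) = t := by field_simp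
  have e2 : (1 + t) / √2 * (√2 * turnWeight t / (1 + t)) = turnWeight t := by field_simp
  simp only [vertex20_apply, crossHV, crossHD, crossVD, Matrix.of_apply]
  revert h
  cases w <;> cases s <;> cases n <;> cases d <;> simp [crossing] <;> linarith

/-- The lowest vertex of the last column if two paths leave it to the South and Southeast. -/
theorem vertex20_corner {t : ℝ} (ht : 0 < t) {w n d : Bool} (h : w.toNat + n.toNat + d.toNat = 2) :
    vertex20 t w true n false d true = if n then (1 + t) / 2 else turnWeight t := by
  have h3 : √2 * √2 = 2 := Real.mul_self_sqrt (by norm_num)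
  have e1 : (1 + t) / √2 * (1 / √2) = (1 + t) / 2 := by rw [div_mul_div_comm, h3, mul_one]
  have e2 := turn_relation ht
  have e3 := straight_relation ht
  simp only [vertex20_apply, crossHV, crossHD, crossVD, Matrix.of_apply]
  revert h
  cases w <;> cases n <;> cases d <;> simp [crossing] <;> simp at e1 e2 e3 <;> linarith

end Weights

/-! ### Sums over edge sets as sums over occupation numbers -/

section SubsetSums

variable {ι : Type*} [DecidableEq ι]

/-- The occupation of an edge. -/
def occ (S : Finset ι) (e : ι) : Bool := decide (e ∈ S)

theorem occ_of_notMem {S : Finset ι} {e : ι} (h : e ∉ S) : occ S e = false := by simp [occ, h]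

theorem occ_eq_occ {S T : Finset ι} {e : ι} : occ S e = occ T e ↔ (e ∈ S ↔ e ∈ T) := by
  simp [occ]

theorem occ_union_of_notMem_right {S T : Finset ι} {e : ι} (h : e ∉ T) :
    occ (S ∪ T) e = occ S e := by
  simp [occ, h]

theorem sum_powerset_union_of_disjoint {R : Type*} [AddCommMonoid R] {A B : Finset ι}
    (h : Disjoint A B) (f : Finset ι → R) :
    ∑ S ∈ (A ∪ B).powerset, f S = ∑ S ∈ A.powerset, ∑ T ∈ B.powerset, f (S ∪ T) := by
  rw [← sum_product']
  refine sum_nbij' (fun S => (S ∩ A, S ∩ B)) (fun S => S.1 ∪ S.2) ?_ ?_ ?_ ?_ ?_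
  · intro S _
    simp
  · intro S hS
    simp only [mem_product, mem_powerset] at hS ⊢
    exact union_subset_union hS.1 hS.2
  · intro S hS
    simp only [mem_powerset] at hS
    rw [← inter_union_distrib_left, inter_eq_left.2 hS]
  · rintro ⟨S, T⟩ hS
    simp only [mem_product, mem_powerset] at hS
    ext e
    · have : e ∈ A → e ∉ B := fun h' => disjoint_left.1 h h'
      have := @hS.1 e
      have := @hS.2 e
      simp only [mem_inter, mem_union]
      tauto
    · have : e ∈ A → e ∉ B := fun h' => disjoint_left.1 h h'
      have := @hS.1 e
      have := @hS.2 e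
      simp only [mem_inter, mem_union]
      tauto
  · intro S hS
    simp only [mem_powerset] at hS
    simp only
    rw [← inter_union_distrib_left, inter_eq_left.2 hS]

theorem sum_powerset_image {R : Type*} [AddCommMonoid R] {k : ℕ} {e : ℕ → ι}
    (he : Function.Injective e) (f : (Fin k → Bool) → R) :
    ∑ S ∈ ((range k).image e).powerset, f (fun i => occ S (e i)) = ∑ x, f x := by
  refine sum_bij' (fun S _ (i : Fin k) => occ S (e i))
    (fun x _ => (univ.filter fun i : Fin k => x i = true).image fun i : Fin k => e i)
    ?_ ?_ ?_ ?_ ?_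
  · simp
  · intro x _
    simp only [mem_powerset]
    intro y hy
    simp only [mem_image, mem_filter] at hy
    obtain ⟨i, -, rfl⟩ := hy
    exact mem_image_of_mem _ (mem_range.2 i.2)
  · intro S hS
    ext y
    simp only [mem_image, mem_filter, mem_univ, true_and, occ, decide_eq_true_eq]
    constructor
    · rintro ⟨i, hi, rfl⟩
      exact hi
    · intro hy
      obtain ⟨i, hi, rfl⟩ := mem_image.1 (mem_powerset.1 hS hy)
      exact ⟨⟨i, mem_range.1 hi⟩, hy, rfl⟩
  · intro x _
    funext i
    simp [occ, he.eq_iff, Fin.val_inj]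
  · simp

end SubsetSums

/-! ### Sums over the configurations of a triangle as iterated layer sums -/

section EdgeFamilies

variable {ι : Type*} [DecidableEq ι] (L R D : ℕ → ℕ → ι)

/-- The edges between the vertices of the first `k` layers of a triangle. The vertex `i < j` of
layer `j` has the inner edges `L j i`, `R j i`, the outer edges `R (j + 1) i`, `L (j + 1) (i + 1)`
and the edges `D j i`, `D j (i + 1)` along the layer. -/
def triangleEdges : ℕ → Finset ι
  | 0 => ∅
  | k + 1 => (((range k).image fun i => R (k + 1) i) ∪ (range k).image fun i => L (k + 1) (i + 1)) ∪
      ((range k).image fun i => D (k + 1) (i + 1)) ∪ triangleEdges k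

/-- The families of edges are injective and disjoint. -/
structure EdgeFamilies : Prop where
  left_inj : ∀ {j i j' i'}, L j i = L j' i' → j = j' ∧ i = i'
  right_inj : ∀ {j i j' i'}, R j i = R j' i' → j = j' ∧ i = i'
  diag_inj : ∀ {j i j' i'}, D j i = D j' i' → j = j' ∧ i = i'
  left_ne_right : ∀ j i j' i', L j i ≠ R j' i'
  left_ne_diag : ∀ j i j' i', L j i ≠ D j' i'
  right_ne_diag : ∀ j i j' i', R j i ≠ D j' i'

variable {L R D}

theorem EdgeFamilies.left_mem (h : EdgeFamilies L R D) {k j i : ℕ} :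
    L j i ∈ triangleEdges L R D k ↔ 0 < i ∧ i < j ∧ j ≤ k := by
  induction k with
  | zero => simp [triangleEdges]; omega
  | succ k ih =>
    simp only [triangleEdges, mem_union, mem_image, mem_range, ih]
    constructor
    · rintro (((⟨a, ha, h'⟩ | ⟨a, ha, h'⟩) | ⟨a, ha, h'⟩) | h')
      · exact absurd h'.symm (h.left_ne_right _ _ _ _)
      · have := h.left_inj h'
        omega
      · exact absurd h'.symm (h.left_ne_diag _ _ _ _)
      · omega
    · intro h'
      by_cases hj : j ≤ k
      · exact Or.inr (by omega)
      · refine Or.inl (Or.inl (Or.inr ⟨i - 1, by omega, ?_⟩))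
        congr 1 <;> omega

theorem EdgeFamilies.right_mem (h : EdgeFamilies L R D) {k j i : ℕ} :
    R j i ∈ triangleEdges L R D k ↔ i + 1 < j ∧ j ≤ k := by
  induction k with
  | zero => simp [triangleEdges]; omega
  | succ k ih =>
    simp only [triangleEdges, mem_union, mem_image, mem_range, ih]
    constructor
    · rintro (((⟨a, ha, h'⟩ | ⟨a, ha, h'⟩) | ⟨a, ha, h'⟩) | h')
      · have := h.right_inj h'
        omega
      · exact absurd h' (h.left_ne_right _ _ _ _)
      · exact absurd h'.symm (h.right_ne_diag _ _ _ _)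
      · omega
    · intro h'
      by_cases hj : j ≤ k
      · exact Or.inr (by omega)
      · refine Or.inl (Or.inl (Or.inl ⟨i, by omega, ?_⟩))
        congr 1; omega

theorem EdgeFamilies.diag_mem (h : EdgeFamilies L R D) {k j i : ℕ} :
    D j i ∈ triangleEdges L R D k ↔ 0 < i ∧ i < j ∧ j ≤ k := by
  induction k with
  | zero => simp [triangleEdges]; omega
  | succ k ih =>
    simp only [triangleEdges, mem_union, mem_image, mem_range, ih]
    constructor
    · rintro (((⟨a, ha, h'⟩ | ⟨a, ha, h'⟩) | ⟨a, ha, h'⟩) | h')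
      · exact absurd h' (h.right_ne_diag _ _ _ _)
      · exact absurd h' (h.left_ne_diag _ _ _ _)
      · have := h.diag_inj h'
        omega
      · omega
    · intro h'
      by_cases hj : j ≤ k
      · exact Or.inr (by omega)
      · refine Or.inl (Or.inr ⟨i - 1, by omega, ?_⟩)
        congr 1 <;> omega

variable (L R D) in
/-- The weight of the `i`-th vertex of the `j`-th layer in a configuration. -/
def layerWeight (G : ℕ → ℕ → Bool → Bool → Bool → Bool → Matrix Bool Bool ℝ) (S : Finset ι)
    (j i : ℕ) : ℝ :=
  G j i (occ S (L j i)) (occ S (R j i)) (occ S (R (j + 1) i)) (occ S (L (j + 1) (i + 1)))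
    (occ S (D j i)) (occ S (D j (i + 1)))

/-- The sum over the configurations on the inner edges of a triangle. -/
theorem sum_triangleEdges (h : EdgeFamilies L R D) (β : Bool)
    (G : ℕ → ℕ → Bool → Bool → Bool → Bool → Matrix Bool Bool ℝ) (k : ℕ) (S : Finset ι)
    (hS : Disjoint S (triangleEdges L R D k))
    (hb : ∀ j, 1 ≤ j → j ≤ k → occ S (L j 0) = β ∧ occ S (R j (j - 1)) = β ∧
      occ S (D j 0) = β ∧ occ S (D j j) = β) :
    ∑ T ∈ (triangleEdges L R D k).powerset,
      ∏ j ∈ range k, ∏ i ∈ range (j + 1), layerWeight L R D G (S ∪ T) (j + 1) i =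
    trianglePF G β k (fun i => occ S (R (k + 1) i)) (fun i => occ S (L (k + 1) (i + 1))) := by
  induction k generalizing S with
  | zero => simp [trianglePF, triangleEdges]
  | succ k ih =>
    have hbound : ∀ {A B : Finset ι} (_ : Disjoint A B) {U V : Finset ι}, U ⊆ A → V ⊆ B →
        Disjoint U V := fun h' _ _ hU hV => disjoint_of_subset_left hU (disjoint_of_subset_right hV h')
    have hAL : Disjoint ((range k).image fun i => R (k + 1) i)
        ((range k).image fun i => L (k + 1) (i + 1)) := by
      simp only [disjoint_left, mem_image]
      rintro _ ⟨i, -, rfl⟩ ⟨j, -, hj⟩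
      exact h.left_ne_right _ _ _ _ hj
    have hAD : Disjoint (((range k).image fun i => R (k + 1) i) ∪
        (range k).image fun i => L (k + 1) (i + 1)) ((range k).image fun i => D (k + 1) (i + 1)) := by
      simp only [disjoint_left, mem_union, mem_image]
      rintro _ (⟨i, -, rfl⟩ | ⟨i, -, rfl⟩) ⟨j, -, hj⟩
      · exact h.right_ne_diag _ _ _ _ hj.symm
      · exact h.left_ne_diag _ _ _ _ hj.symm
    have hAT : Disjoint ((((range k).image fun i => R (k + 1) i) ∪
        (range k).image fun i => L (k + 1) (i + 1)) ∪ (range k).image fun i => D (k + 1) (i + 1))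
        (triangleEdges L R D k) := by
      simp only [disjoint_left, mem_union, mem_image]
      rintro _ ((⟨i, -, rfl⟩ | ⟨i, -, rfl⟩) | ⟨i, -, rfl⟩)
      · rw [h.right_mem]; omega
      · rw [h.left_mem]; omega
      · rw [h.diag_mem]; omega
    rw [triangleEdges, sum_powerset_union_of_disjoint hAT, sum_powerset_union_of_disjoint hAD,
      sum_powerset_union_of_disjoint hAL, trianglePF]
    rw [← sum_powerset_image (e := fun i => R (k + 1) i) (fun i j hij => (h.right_inj hij).2)]
    refine sum_congr rfl fun TR hTR => ?_
    rw [← sum_powerset_image (e := fun i => L (k + 1) (i + 1))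
      (fun i j hij => by have := (h.left_inj hij).2; omega)]
    refine sum_congr rfl fun TL hTL => ?_
    -- The edges along the layer are the intermediate indices of the matrix product; those to its
    -- inner side were matched with the two sums in `trianglePF`.
    rw [orderedProd_matrix_apply, ← sum_powerset_image (e := fun i => D (k + 1) (i + 1))
      (fun i j hij => by have := (h.diag_inj hij).2; omega), mul_sum]
    refine sum_congr rfl fun TD hTD => ?_
    rw [mem_powerset] at hTR hTL hTD
    have mR : ∀ {e}, e ∈ TR → ∃ i, i < k ∧ R (k + 1) i = e := fun he => by
      simpa using hTR he
    have mL : ∀ {e}, e ∈ TL → ∃ i, i < k ∧ L (k + 1) (i + 1) = e := fun he => by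
      simpa using hTL he
    have mD : ∀ {e}, e ∈ TD → ∃ i, i < k ∧ D (k + 1) (i + 1) = e := fun he => by
      simpa using hTD he
    have nRL : ∀ {j i}, L j i ∉ TR := fun he => by
      obtain ⟨_, _, h'⟩ := mR he; exact h.left_ne_right _ _ _ _ h'.symm
    have nRD : ∀ {j i}, D j i ∉ TR := fun he => by
      obtain ⟨_, _, h'⟩ := mR he; exact h.right_ne_diag _ _ _ _ h'
    have nLR : ∀ {j i}, R j i ∉ TL := fun he => by
      obtain ⟨_, _, h'⟩ := mL he; exact h.left_ne_right _ _ _ _ h'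
    have nLD : ∀ {j i}, D j i ∉ TL := fun he => by
      obtain ⟨_, _, h'⟩ := mL he; exact h.left_ne_diag _ _ _ _ h'
    have nDR : ∀ {j i}, R j i ∉ TD := fun he => by
      obtain ⟨_, _, h'⟩ := mD he; exact h.right_ne_diag _ _ _ _ h'.symm
    have nDL : ∀ {j i}, L j i ∉ TD := fun he => by
      obtain ⟨_, _, h'⟩ := mD he; exact h.left_ne_diag _ _ _ _ h'.symm
    have nR : ∀ {j i}, ¬ (j = k + 1 ∧ i < k) → R j i ∉ TR := fun hn he => by
      obtain ⟨_, _, h'⟩ := mR he; have := h.right_inj h'; omega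
    have nL : ∀ {j i}, ¬ (j = k + 1 ∧ 0 < i ∧ i < k + 1) → L j i ∉ TL := fun hn he => by
      obtain ⟨_, _, h'⟩ := mL he; have := h.left_inj h'; omega
    have nD : ∀ {j i}, ¬ (j = k + 1 ∧ 0 < i ∧ i < k + 1) → D j i ∉ TD := fun hn he => by
      obtain ⟨_, _, h'⟩ := mD he; have := h.diag_inj h'; omega
    have sR : ∀ {i}, i < k → R (k + 1) i ∉ S := fun hi he =>
      disjoint_left.1 hS he (h.right_mem.2 (by omega))
    have sL : ∀ {i}, i < k → L (k + 1) (i + 1) ∉ S := fun hi he =>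
      disjoint_left.1 hS he (h.left_mem.2 (by omega))
    have sD : ∀ {i}, i < k → D (k + 1) (i + 1) ∉ S := fun hi he =>
      disjoint_left.1 hS he (h.diag_mem.2 (by omega))
    set S' := S ∪ ((TR ∪ TL) ∪ TD) with hS'
    have oR : ∀ {j i}, occ S' (R j i) = (occ S (R j i) || occ TR (R j i)) := by
      intro j i
      simp [occ, hS', nLR, nDR]
    have oL : ∀ {j i}, occ S' (L j i) = (occ S (L j i) || occ TL (L j i)) := by
      intro j i
      simp [occ, hS', nRL, nDL]
    have oD : ∀ {j i}, occ S' (D j i) = (occ S (D j i) || occ TD (D j i)) := by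
      intro j i
      simp [occ, hS', nRD, nLD]
    have fR : ∀ i : Fin (k + 1), occ S' (R (k + 1) i) =
        (Fin.snoc (fun i : Fin k => occ TR (R (k + 1) i)) β : Fin (k + 1) → Bool) i := by
      intro i
      refine Fin.lastCases ?_ (fun i => ?_) i
      · rw [oR, occ_of_notMem (nR (by simp)), Bool.or_false]
        simpa using (hb (k + 1) (by omega) le_rfl).2.1
      · rw [oR]
        simp [occ_of_notMem (sR i.2)]
    have fL : ∀ i : Fin (k + 1), occ S' (L (k + 1) i) =
        (Fin.cons β (fun i : Fin k => occ TL (L (k + 1) (i + 1))) : Fin (k + 1) → Bool) i := by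
      intro i
      refine Fin.cases ?_ (fun i => ?_) i
      · rw [oL, occ_of_notMem (nL (by simp)), Bool.or_false]
        simpa using (hb (k + 1) (by omega) le_rfl).1
      · rw [oL]
        simp [occ_of_notMem (sL i.2)]
    have fD : ∀ i : Fin (k + 1), occ S' (D (k + 1) i) =
        (Fin.cons β (fun i : Fin k => occ TD (D (k + 1) (i + 1))) : Fin (k + 1) → Bool) i := by
      intro i
      refine Fin.cases ?_ (fun i => ?_) i
      · rw [oD, occ_of_notMem (nD (by simp)), Bool.or_false]
        simpa using (hb (k + 1) (by omega) le_rfl).2.2.1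
      · rw [oD]
        simp [occ_of_notMem (sD i.2)]
    have fD' : ∀ i : Fin (k + 1), occ S' (D (k + 1) (i + 1)) =
        (Fin.snoc (fun i : Fin k => occ TD (D (k + 1) (i + 1))) β : Fin (k + 1) → Bool) i := by
      intro i
      refine Fin.lastCases ?_ (fun i => ?_) i
      · rw [oD, occ_of_notMem (nD (by simp)), Bool.or_false]
        simpa using (hb (k + 1) (by omega) le_rfl).2.2.2
      · rw [oD]
        simp [occ_of_notMem (sD i.2)]
    have fp : ∀ i, occ S' (R (k + 1 + 1) i) = occ S (R (k + 1 + 1) i) := by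
      intro i
      rw [oR, occ_of_notMem (nR (by simp)), Bool.or_false]
    have fq : ∀ i, occ S' (L (k + 1 + 1) i) = occ S (L (k + 1 + 1) i) := by
      intro i
      rw [oL, occ_of_notMem (nL (by simp)), Bool.or_false]
    -- The outermost layer does not see the edges inside the first k layers, so its weight factors
    -- out of the sum over them.
    have hlast : ∀ T ∈ (triangleEdges L R D k).powerset, ∀ i ∈ range (k + 1),
        layerWeight L R D G (S' ∪ T) (k + 1) i = layerWeight L R D G S' (k + 1) i := by
      intro T hT i _
      rw [mem_powerset] at hT
      simp only [layerWeight]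
      congr 1
      all_goals try
        refine occ_union_of_notMem_right fun he => ?_
        have := hT he
        first
          | rw [h.right_mem] at this; omega
          | rw [h.left_mem] at this; omega
          | rw [h.diag_mem] at this; omega
    calc
      _ = ∑ T ∈ (triangleEdges L R D k).powerset,
          (∏ j ∈ range k, ∏ i ∈ range (j + 1), layerWeight L R D G (S' ∪ T) (j + 1) i) *
            ∏ i ∈ range (k + 1), layerWeight L R D G S' (k + 1) i := by
        refine sum_congr rfl fun T hT => ?_
        rw [← union_assoc, prod_range_succ, prod_congr rfl (hlast T hT)]
      _ = _ := by
        rw [← sum_mul, ih S']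
        · congr 1
          · congr 1 <;> funext i
            · simpa using fR i.castSucc
            · simpa using fL i.succ
          · rw [prod_range]
            refine prod_congr rfl fun i _ => ?_
            simp only [layerWeight, fR, fL, fD, fD', fp, fq]
        · refine disjoint_union_left.2 ⟨?_, hbound hAT ?_ subset_rfl⟩
          · exact disjoint_of_subset_right (by rw [triangleEdges]; exact subset_union_right) hS
          · exact union_subset_union (union_subset_union hTR hTL) hTD
        · intro j hj hjk
          have := hb j hj (by omega)
          simp only [oR, oL, oD]
          rw [this.1, this.2.1, this.2.2.1, this.2.2.2]
          have h1 : occ TL (L j 0) = false := by simpa [occ] using nL (by omega)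
          have h2 : occ TR (R j (j - 1)) = false := by simpa [occ] using nR (by omega)
          have h3 : occ TD (D j 0) = false := by simpa [occ] using nD (by omega)
          have h4 : occ TD (D j j) = false := by simpa [occ] using nD (by omega)
          simp [h1, h2, h3, h4]

end EdgeFamilies

/-! ### The grid cut along an antidiagonal into two triangles -/

section Geometry

theorem mem_grid {n : ℕ} {x y : ℤ} : (x, y) ∈ grid n ↔ (1 ≤ x ∧ x ≤ n) ∧ 1 ≤ y ∧ y ≤ n := by
  simp [grid]

theorem mem_edges_horizontal {n : ℕ} {x y : ℤ} :
    ((Step.horizontal, (x, y)) : Edge) ∈ edges triangularSteps n ↔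
      n ≠ 0 ∧ 0 ≤ x ∧ x ≤ n ∧ 1 ≤ y ∧ y ≤ n := by
  rw [edges, mem_filter, mem_product, mem_product, triangularSteps]
  simp only [mem_Icc, tail, head, Step.vec, Prod.mk_add_mk, mem_grid]
  simp only [mem_insert, mem_singleton, true_or, true_and]
  omega

theorem mem_edges_vertical {n : ℕ} {x y : ℤ} :
    ((Step.vertical, (x, y)) : Edge) ∈ edges triangularSteps n ↔
      n ≠ 0 ∧ 1 ≤ x ∧ x ≤ n ∧ 1 ≤ y ∧ y ≤ n + 1 := by
  rw [edges, mem_filter, mem_product, mem_product, triangularSteps]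
  simp only [mem_Icc, tail, head, Step.vec, Prod.mk_add_mk, mem_grid]
  simp only [mem_insert, mem_singleton, true_or, or_true, true_and]
  omega

theorem mem_edges_diagonal {n : ℕ} {x y : ℤ} :
    ((Step.diagonal, (x, y)) : Edge) ∈ edges triangularSteps n ↔
      n ≠ 0 ∧ 0 ≤ x ∧ x ≤ n ∧ 1 ≤ y ∧ y ≤ n + 1 ∧ (x = 0 → 2 ≤ y) ∧ (y = n + 1 → x < n) := by
  rw [edges, mem_filter, mem_product, mem_product, triangularSteps]
  simp only [mem_Icc, tail, head, Step.vec, Prod.mk_add_mk, mem_grid]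
  simp only [mem_insert, mem_singleton, or_true, true_and]
  omega

/-- The edges between two vertices of the grid. -/
noncomputable def innerEdges (n : ℕ) : Finset Edge :=
  (edges triangularSteps n).filter fun e => tail e ∈ grid n ∧ head e ∈ grid n

theorem mem_innerEdges_horizontal {n : ℕ} {x y : ℤ} :
    ((Step.horizontal, (x, y)) : Edge) ∈ innerEdges n ↔ 1 ≤ x ∧ x < n ∧ 1 ≤ y ∧ y ≤ n := by
  rw [innerEdges, mem_filter, mem_edges_horizontal]
  simp only [tail, head, Step.vec, Prod.mk_add_mk, mem_grid]
  omega

theorem mem_innerEdges_vertical {n : ℕ} {x y : ℤ} :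
    ((Step.vertical, (x, y)) : Edge) ∈ innerEdges n ↔ 1 ≤ x ∧ x ≤ n ∧ 2 ≤ y ∧ y ≤ n := by
  rw [innerEdges, mem_filter, mem_edges_vertical]
  simp only [tail, head, Step.vec, Prod.mk_add_mk, mem_grid]
  omega

theorem mem_innerEdges_diagonal {n : ℕ} {x y : ℤ} :
    ((Step.diagonal, (x, y)) : Edge) ∈ innerEdges n ↔ 1 ≤ x ∧ x < n ∧ 2 ≤ y ∧ y ≤ n := by
  rw [innerEdges, mem_filter, mem_edges_diagonal]
  simp only [tail, head, Step.vec, Prod.mk_add_mk, mem_grid]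
  omega

/-- The number of antidiagonal layers whose diagonal line carries path steps at its ends. -/
def cut : DWBCType → ℕ → ℕ
  | .bc1, n => n
  | .bc2, n => n - 1

/-- The boundary edges that have the natural orientation. -/
def Filled (t : DWBCType) (n : ℕ) : Edge → Prop
  | (.horizontal, (x, _)) => x = 0
  | (.vertical, (_, y)) => y = 1
  | (.diagonal, (x, y)) => x + y ≤ cut t n + 1

/-- The boundary conditions of the 20V model. -/
def BoundaryCondition (t : DWBCType) (n : ℕ) (S : Finset Edge) : Prop :=
  SquareDWBC n S ∧ DiagonalDWBC n S ∧ CornerDWBC n S t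

/-- Both types prescribe every boundary edge. For diagonal edges only the antidiagonal matters, so
the types differ in a single threshold, on either side of the line through the two corner edges. -/
theorem boundaryCondition_iff {t : DWBCType} {n : ℕ} (hn : 1 ≤ n) {S : Finset Edge} :
    BoundaryCondition t n S ↔
      ∀ e ∈ edges triangularSteps n, e ∉ innerEdges n → (e ∈ S ↔ Filled t n e) := by
  constructor
  · rintro ⟨⟨hW, hS, hE, hN⟩, ⟨dW, dS, dE, dN⟩, hC⟩ ⟨st, x, y⟩ he hi
    cases st
    · rw [mem_edges_horizontal] at he
      rw [mem_innerEdges_horizontal] at hi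
      simp only [Filled]
      obtain rfl | rfl : x = 0 ∨ x = n := by omega
      · simpa using hW y (by rw [mem_Icc]; omega)
      · have := hE y (by rw [mem_Icc]; omega)
        simp only [this, false_iff]
        omega
    · rw [mem_edges_vertical] at he
      rw [mem_innerEdges_vertical] at hi
      simp only [Filled]
      obtain rfl | rfl : y = 1 ∨ y = n + 1 := by omega
      · simpa using hS x (by rw [mem_Icc]; omega)
      · have := hN x (by rw [mem_Icc]; omega)
        simp only [this, false_iff]
        omega
    · rw [mem_edges_diagonal] at he
      rw [mem_innerEdges_diagonal] at hi
      simp only [Filled]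
      by_cases hc : x + y = n + 1
      · have hxy : (x = 0 ∧ y = n + 1) ∨ (x = n ∧ y = 1) := by omega
        cases t
        · have h' : x + y ≤ cut .bc1 n + 1 := by simp only [cut]; omega
          simp only [h', iff_true]
          rcases hxy with ⟨rfl, rfl⟩ | ⟨rfl, rfl⟩
          exacts [hC.1, hC.2]
        · have h' : ¬ x + y ≤ cut .bc2 n + 1 := by simp only [cut]; omega
          simp only [h', iff_false]
          rcases hxy with ⟨rfl, rfl⟩ | ⟨rfl, rfl⟩
          exacts [hC.1, hC.2]
      -- Off the antidiagonal x + y = n + 1 of the corner edges the two thresholds agree.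
      · have hcut : x + y ≤ cut t n + 1 ↔ x + y ≤ n := by cases t <;> simp only [cut] <;> omega
        rw [hcut]
        have : x = 0 ∨ y = 1 ∨ x = n ∨ y = n + 1 := by omega
        by_cases h' : x + y ≤ n
        · simp only [h', iff_true]
          obtain rfl | rfl : x = 0 ∨ y = 1 := by omega
          · simpa using dW (y - 1) (by rw [mem_Icc]; omega)
          · exact dS x (by rw [mem_Icc]; omega)
        · simp only [h', iff_false]
          obtain rfl | rfl : x = n ∨ y = n + 1 := by omega
          · simpa using dE (y - 1) (by rw [mem_Icc]; omega)
          · exact dN x (by rw [mem_Icc]; omega)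
  · intro h
    have hcut : cut t n ≤ n ∧ n ≤ cut t n + 1 := by cases t <;> simp only [cut] <;> omega
    refine ⟨⟨fun y hy => ?_, fun x hx => ?_, fun y hy => ?_, fun x hx => ?_⟩,
      ⟨fun y hy => ?_, fun x hx => ?_, fun y hy => ?_, fun x hx => ?_⟩, ?_⟩
    · rw [mem_Icc] at hy
      rw [h _ (mem_edges_horizontal.2 (by omega)) (by rw [mem_innerEdges_horizontal]; omega)]
      rfl
    · rw [mem_Icc] at hx
      rw [h _ (mem_edges_vertical.2 (by omega)) (by rw [mem_innerEdges_vertical]; omega)]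
      rfl
    · rw [mem_Icc] at hy
      rw [h _ (mem_edges_horizontal.2 (by omega)) (by rw [mem_innerEdges_horizontal]; omega)]
      simp only [Filled]
      omega
    · rw [mem_Icc] at hx
      rw [h _ (mem_edges_vertical.2 (by omega)) (by rw [mem_innerEdges_vertical]; omega)]
      simp only [Filled]
      omega
    · rw [mem_Icc] at hy
      rw [h _ (mem_edges_diagonal.2 (by omega)) (by rw [mem_innerEdges_diagonal]; omega)]
      simp only [Filled]
      omega
    · rw [mem_Icc] at hx
      rw [h _ (mem_edges_diagonal.2 (by omega)) (by rw [mem_innerEdges_diagonal]; omega)]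
      simp only [Filled]
      omega
    · rw [mem_Icc] at hy
      rw [h _ (mem_edges_diagonal.2 (by omega)) (by rw [mem_innerEdges_diagonal]; omega)]
      simp only [Filled]
      omega
    · rw [mem_Icc] at hx
      rw [h _ (mem_edges_diagonal.2 (by omega)) (by rw [mem_innerEdges_diagonal]; omega)]
      simp only [Filled]
      omega
    · have h1 := h (upperLeftCorner n) (mem_edges_diagonal.2 (by omega))
        (by rw [upperLeftCorner, mem_innerEdges_diagonal]; omega)
      have h2 := h (lowerRightCorner n) (mem_edges_diagonal.2 (by omega))
        (by rw [lowerRightCorner, mem_innerEdges_diagonal]; omega)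
      cases t <;> simp only [CornerDWBC, h1, h2] <;>
        simp only [upperLeftCorner, lowerRightCorner, Filled, cut] <;> omega

/-- The configurations that satisfy the boundary conditions but not necessarily the ice rule. -/
noncomputable def boundaryConfigs (t : DWBCType) (n : ℕ) : Finset (Finset Edge) :=
  open Classical in (edges triangularSteps n).powerset.filter (BoundaryCondition t n)

/-- The boundary edges that carry a path step. -/
noncomputable def filledEdges (t : DWBCType) (n : ℕ) : Finset Edge :=
  open Classical in
  (edges triangularSteps n).filter fun e => e ∉ innerEdges n ∧ Filled t n e

theorem mem_filledEdges {t : DWBCType} {n : ℕ} {e : Edge} :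
    e ∈ filledEdges t n ↔ e ∈ edges triangularSteps n ∧ e ∉ innerEdges n ∧ Filled t n e := by
  classical
  simp [filledEdges]

/-- The boundary part of a configuration is fixed, and its inner part is arbitrary because the ice
rule is not imposed here; the vertex weights take care of it. -/
theorem sum_boundaryConfigs {t : DWBCType} {n : ℕ} (hn : 1 ≤ n) (f : Finset Edge → ℝ) :
    ∑ S ∈ boundaryConfigs t n, f S =
      ∑ T ∈ (innerEdges n).powerset, f (filledEdges t n ∪ T) := by
  classical
  have key : ∀ S ∈ boundaryConfigs t n, filledEdges t n ∪ S ∩ innerEdges n = S := by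
    intro S hS
    simp only [boundaryConfigs, mem_filter, mem_powerset, boundaryCondition_iff hn] at hS
    ext e
    have h1 := @hS.1 e
    have h2 := hS.2 e
    rw [mem_union, mem_inter, mem_filledEdges]
    by_cases hi : e ∈ innerEdges n
    · simp [hi]
    · simp only [hi, not_false_eq_true, true_and, and_false, or_false]
      exact ⟨fun h => (h2 h.1 hi).2 h.2, fun h => ⟨h1 h, (h2 (h1 h) hi).1 h⟩⟩
  refine sum_nbij' (fun S => S ∩ innerEdges n) (fun T => filledEdges t n ∪ T) ?_ ?_ key ?_ ?_
  · intro S _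
    simp
  · intro T hT
    simp only [mem_powerset] at hT
    simp only [boundaryConfigs, mem_filter, mem_powerset, boundaryCondition_iff hn]
    refine ⟨union_subset (fun e he => (mem_filledEdges.1 he).1)
      (hT.trans (filter_subset _ _)), fun e he hi => ?_⟩
    rw [mem_union, mem_filledEdges]
    exact ⟨fun h => h.elim (fun h => h.2.2) fun h => absurd (hT h) hi, fun h => Or.inl ⟨he, hi, h⟩⟩
  · intro T hT
    simp only [mem_powerset] at hT
    ext e
    rw [mem_inter, mem_union, mem_filledEdges]
    exact ⟨fun h => h.1.elim (fun h' => absurd h.2 h'.2.1) id, fun h => ⟨Or.inr h, hT h⟩⟩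
  · intro S hS
    rw [key S hS]

/-! The lower left and the upper right triangle of the grid. -/

/-- Vertex i of layer j is (i + 1, j - i). Its inner edges go West and South, its outer edges North
and East, and the layers grow away from the lower left corner. -/
def lowerLeft (j i : ℕ) : Edge := (Step.horizontal, ((i : ℤ), (j : ℤ) - i))
def lowerRight (j i : ℕ) : Edge := (Step.vertical, ((i : ℤ) + 1, (j : ℤ) - i))
def lowerDiag (j i : ℕ) : Edge := (Step.diagonal, ((i : ℤ), (j : ℤ) - i + 1))
-- Vertex i of layer j is (n - j + 1 + i, n - i). Here the inner edges go North and East and the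
-- outer ones West and South, with layers counted from the upper right corner.
def upperLeft (n j i : ℕ) : Edge := (Step.vertical, ((n : ℤ) - j + 1 + i, (n : ℤ) - i + 1))
def upperRight (n j i : ℕ) : Edge := (Step.horizontal, ((n : ℤ) - j + 1 + i, (n : ℤ) - i))
def upperDiag (n j i : ℕ) : Edge := (Step.diagonal, ((n : ℤ) - j + i, (n : ℤ) - i + 1))

theorem lower_edgeFamilies : EdgeFamilies lowerLeft lowerRight lowerDiag := by
  constructor <;> intros <;>
    simp only [lowerLeft, lowerRight, lowerDiag, Prod.mk.injEq, true_and, ne_eq, reduceCtorEq,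
      false_and, not_false_eq_true] at * <;> omega

theorem upper_edgeFamilies (n : ℕ) : EdgeFamilies (upperLeft n) (upperRight n) (upperDiag n) := by
  constructor <;> intros <;>
    simp only [upperLeft, upperRight, upperDiag, Prod.mk.injEq, true_and, ne_eq, reduceCtorEq,
      false_and, not_false_eq_true] at * <;> omega

theorem forall_mem_triangleEdges {ι : Type*} [DecidableEq ι] {L R D : ℕ → ℕ → ι} {k : ℕ}
    {P : ι → Prop} (hL : ∀ j i, 0 < i → i < j → j ≤ k → P (L j i))
    (hR : ∀ j i, i + 1 < j → j ≤ k → P (R j i))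
    (hD : ∀ j i, 0 < i → i < j → j ≤ k → P (D j i)) {e : ι} (he : e ∈ triangleEdges L R D k) :
    P e := by
  induction k with
  | zero => simp [triangleEdges] at he
  | succ k ih =>
    simp only [triangleEdges, mem_union, mem_image, mem_range] at he
    rcases he with ((⟨i, hi, rfl⟩ | ⟨i, hi, rfl⟩) | ⟨i, hi, rfl⟩) | he
    · exact hR _ _ (by omega) le_rfl
    · exact hL _ _ (by omega) (by omega) le_rfl
    · exact hD _ _ (by omega) (by omega) le_rfl
    · exact ih (fun j i h1 h2 h3 => hL j i h1 h2 (by omega)) (fun j i h1 h2 => hR j i h1 (by omega))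
        (fun j i h1 h2 h3 => hD j i h1 h2 (by omega)) he

/-- A height function that separates the edges of the two triangles. -/
def height : Edge → ℤ
  | (.horizontal, (x, y)) => 2 * (x + y)
  | (.vertical, (x, y)) => 2 * (x + y) - 2
  | (.diagonal, (x, y)) => 2 * (x + y) - 1

/-- The inner edges of the lower left triangle with `a` layers. -/
def lowerEdges (a : ℕ) : Finset Edge := triangleEdges lowerLeft lowerRight lowerDiag a

/-- The inner edges of the upper right triangle with `b` layers. -/
def upperEdges (n b : ℕ) : Finset Edge :=
  triangleEdges (upperLeft n) (upperRight n) (upperDiag n) b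

theorem height_of_mem_lowerEdges {a : ℕ} {e : Edge} (he : e ∈ lowerEdges a) :
    height e ≤ 2 * a + 1 := by
  refine forall_mem_triangleEdges (P := fun e => height e ≤ 2 * (a : ℤ) + 1) ?_ ?_ ?_ he <;>
    intros <;> simp only [height, lowerLeft, lowerRight, lowerDiag] <;> omega

theorem height_of_mem_upperEdges {n b : ℕ} {e : Edge} (he : e ∈ upperEdges n b) :
    4 * (n : ℤ) - 2 * b + 1 ≤ height e := by
  refine forall_mem_triangleEdges (P := fun e => 4 * (n : ℤ) - 2 * b + 1 ≤ height e) ?_ ?_ ?_ he <;>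
    intros <;> simp only [height, upperLeft, upperRight, upperDiag] <;> omega

theorem lowerEdges_subset {n a : ℕ} (ha : a ≤ n) : lowerEdges a ⊆ innerEdges n := by
  intro e he
  refine forall_mem_triangleEdges (P := fun e => e ∈ innerEdges n) ?_ ?_ ?_ he <;> intros <;>
    simp only [lowerLeft, lowerRight, lowerDiag, mem_innerEdges_horizontal,
      mem_innerEdges_vertical, mem_innerEdges_diagonal] <;> omega

theorem upperEdges_subset {n b : ℕ} (hb : b ≤ n) : upperEdges n b ⊆ innerEdges n := by
  intro e he
  refine forall_mem_triangleEdges (P := fun e => e ∈ innerEdges n) ?_ ?_ ?_ he <;> intros <;>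
    simp only [upperLeft, upperRight, upperDiag, mem_innerEdges_horizontal,
      mem_innerEdges_vertical, mem_innerEdges_diagonal] <;> omega

/-- The grid has 2n - 1 antidiagonals; the first a belong to the lower triangle and the last b to
the upper one. -/
theorem prod_grid {n a b : ℕ} (ha : a ≤ n) (hb : b ≤ n) (hab : a + b + 1 = 2 * n)
    (f : ℤ × ℤ → ℝ) :
    ∏ v ∈ grid n, f v =
      (∏ j ∈ range a, ∏ i ∈ range (j + 1), f ((i : ℤ) + 1, (j : ℤ) + 1 - i)) *
      ∏ j ∈ range b, ∏ i ∈ range (j + 1), f ((n : ℤ) - j + i, (n : ℤ) - i) := by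
  rw [← prod_filter_mul_prod_filter_not (grid n) fun v => v.1 + v.2 ≤ (a : ℤ) + 1]
  congr 1
  · rw [prod_sigma']
    refine prod_nbij' (fun v => ⟨(v.1 + v.2 - 2).toNat, (v.1 - 1).toNat⟩)
      (fun s => ((s.2 : ℤ) + 1, (s.1 : ℤ) + 1 - s.2)) ?_ ?_ ?_ ?_ ?_
    · rintro ⟨x, y⟩ h
      simp only [mem_filter, mem_grid] at h
      simp only [mem_sigma, mem_range]
      omega
    · rintro ⟨j, i⟩ h
      simp only [mem_sigma, mem_range] at h
      simp only [mem_filter, mem_grid]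
      omega
    · rintro ⟨x, y⟩ h
      simp only [mem_filter, mem_grid] at h
      simp only [Prod.mk.injEq]
      omega
    · rintro ⟨j, i⟩ h
      simp only [mem_sigma, mem_range] at h
      simp only [Sigma.mk.injEq, heq_eq_eq]
      omega
    · rintro ⟨x, y⟩ h
      simp only [mem_filter, mem_grid] at h
      congr 1
      simp only [Prod.mk.injEq]
      omega
  · rw [prod_sigma']
    refine prod_nbij' (fun v => ⟨(2 * n - v.1 - v.2).toNat, (n - v.2).toNat⟩)
      (fun s => ((n : ℤ) - s.1 + s.2, (n : ℤ) - s.2)) ?_ ?_ ?_ ?_ ?_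
    · rintro ⟨x, y⟩ h
      simp only [mem_filter, mem_grid] at h
      simp only [mem_sigma, mem_range]
      omega
    · rintro ⟨j, i⟩ h
      simp only [mem_sigma, mem_range] at h
      simp only [mem_filter, mem_grid]
      omega
    · rintro ⟨x, y⟩ h
      simp only [mem_filter, mem_grid] at h
      simp only [Prod.mk.injEq]
      omega
    · rintro ⟨j, i⟩ h
      simp only [mem_sigma, mem_range] at h
      simp only [Sigma.mk.injEq, heq_eq_eq]
      omega
    · rintro ⟨x, y⟩ h
      simp only [mem_filter, mem_grid] at h
      congr 1
      simp only [Prod.mk.injEq]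
      omega

end Geometry

/-! ### Gluing the two triangles and removing all diagonal lines -/

section Gluing

/-- The weight of the vertex `v`, where `g` depends on the column and on the edges to the West,
South, North and East. -/
def siteWeight (g : ℤ → Bool → Bool → Bool → Bool → Matrix Bool Bool ℝ) (S : Finset Edge)
    (v : ℤ × ℤ) : ℝ :=
  g v.1 (occ S (Step.horizontal, (v.1 - 1, v.2))) (occ S (Step.vertical, (v.1, v.2)))
    (occ S (Step.vertical, (v.1, v.2 + 1))) (occ S (Step.horizontal, (v.1, v.2)))
    (occ S (Step.diagonal, (v.1 - 1, v.2 + 1))) (occ S (Step.diagonal, (v.1, v.2)))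

variable (g : ℤ → Bool → Bool → Bool → Bool → Matrix Bool Bool ℝ)

/-- The vertices of the lower left triangle. -/
def lowerVertex (_ i : ℕ) (l r p q : Bool) : Matrix Bool Bool ℝ := g ((i : ℤ) + 1) l r p q

/-- The vertices of the upper right triangle. -/
def upperVertex (n j i : ℕ) (l r p q : Bool) : Matrix Bool Bool ℝ :=
  g ((n : ℤ) - j + 1 + i) p q l r

theorem siteWeight_lower (S : Finset Edge) (j i : ℕ) :
    siteWeight g S ((i : ℤ) + 1, (j : ℤ) + 1 - i) =
      layerWeight lowerLeft lowerRight lowerDiag (lowerVertex g) S (j + 1) i := by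
  simp only [siteWeight, layerWeight, lowerVertex, lowerLeft, lowerRight, lowerDiag]
  push_cast
  ring_nf

theorem siteWeight_upper (n : ℕ) (S : Finset Edge) (j i : ℕ) :
    siteWeight g S ((n : ℤ) - j + i, (n : ℤ) - i) =
      layerWeight (upperLeft n) (upperRight n) (upperDiag n) (upperVertex g n) S (j + 1) i := by
  simp only [siteWeight, layerWeight, upperVertex, upperLeft, upperRight, upperDiag]
  push_cast
  ring_nf

theorem prod_siteWeight {n a b : ℕ} (ha : a ≤ n) (hb : b ≤ n) (hab : a + b + 1 = 2 * n)
    (S : Finset Edge) :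
    ∏ v ∈ grid n, siteWeight g S v =
      (∏ j ∈ range a, ∏ i ∈ range (j + 1),
        layerWeight lowerLeft lowerRight lowerDiag (lowerVertex g) S (j + 1) i) *
      ∏ j ∈ range b, ∏ i ∈ range (j + 1),
        layerWeight (upperLeft n) (upperRight n) (upperDiag n) (upperVertex g n) S (j + 1) i := by
  rw [prod_grid ha hb hab]
  simp only [siteWeight_lower, siteWeight_upper]

theorem layerWeight_congr {L R D : ℕ → ℕ → Edge}
    {G : ℕ → ℕ → Bool → Bool → Bool → Bool → Matrix Bool Bool ℝ} {S T : Finset Edge} {j i : ℕ}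
    (P : Edge → Prop) (hST : ∀ e, P e → (e ∈ S ↔ e ∈ T)) (h1 : P (L j i)) (h2 : P (R j i))
    (h3 : P (R (j + 1) i)) (h4 : P (L (j + 1) (i + 1))) (h5 : P (D j i)) (h6 : P (D j (i + 1))) :
    layerWeight L R D G S j i = layerWeight L R D G T j i := by
  simp only [layerWeight, occ_eq_occ.2 (hST _ h1), occ_eq_occ.2 (hST _ h2),
    occ_eq_occ.2 (hST _ h3), occ_eq_occ.2 (hST _ h4), occ_eq_occ.2 (hST _ h5),
    occ_eq_occ.2 (hST _ h6)]

/-- The inner edges between the two triangles. -/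
noncomputable def glueEdges (n a b : ℕ) : Finset Edge :=
  innerEdges n \ (lowerEdges a ∪ upperEdges n b)

/-- The partition function is a sum of products of partition functions of the two triangles. -/
theorem sum_boundaryConfigs_eq (t : DWBCType) {n a b : ℕ} (hn : 1 ≤ n) (ha : a = cut t n)
    (hab : a + b + 1 = 2 * n) :
    ∑ S ∈ boundaryConfigs t n, ∏ v ∈ grid n, siteWeight g S v =
      ∑ T ∈ (glueEdges n a b).powerset,
        trianglePF (lowerVertex g) true a
          (fun i => occ (filledEdges t n ∪ T) (lowerRight (a + 1) i))
          (fun i => occ (filledEdges t n ∪ T) (lowerLeft (a + 1) (i + 1))) *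
        trianglePF (upperVertex g n) false b
          (fun i => occ (filledEdges t n ∪ T) (upperRight n (b + 1) i))
          (fun i => occ (filledEdges t n ∪ T) (upperLeft n (b + 1) (i + 1))) := by
  have hcut : a ≤ n ∧ n ≤ a + 1 := by cases t <;> simp only [cut] at ha <;> omega
  have haz : (cut t n : ℤ) = a := by rw [ha]
  have hlu : Disjoint (lowerEdges a) (upperEdges n b) := disjoint_left.2 fun e h1 h2 => by
    have := height_of_mem_lowerEdges h1
    have := height_of_mem_upperEdges h2
    omega
  have hgl : Disjoint (glueEdges n a b) (lowerEdges a) :=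
    disjoint_of_subset_right subset_union_left sdiff_disjoint
  have hgu : Disjoint (glueEdges n a b) (upperEdges n b) :=
    disjoint_of_subset_right subset_union_right sdiff_disjoint
  have hsub : lowerEdges a ∪ upperEdges n b ⊆ innerEdges n :=
    union_subset (lowerEdges_subset hcut.1) (upperEdges_subset (by omega))
  have hinner : innerEdges n = (glueEdges n a b ∪ lowerEdges a) ∪ upperEdges n b := by
    rw [union_assoc, glueEdges, sdiff_union_of_subset hsub]
  rw [sum_boundaryConfigs hn, hinner,
    sum_powerset_union_of_disjoint (disjoint_union_left.2 ⟨hgu, hlu⟩),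
    sum_powerset_union_of_disjoint hgl]
  refine sum_congr rfl fun T hT => ?_
  rw [mem_powerset] at hT
  have hF : ∀ e, e ∈ filledEdges t n → e ∉ innerEdges n := fun e he => (mem_filledEdges.1 he).2.1
  have hTi : T ⊆ innerEdges n := hT.trans sdiff_subset
  have hocc : ∀ e ∈ edges triangularSteps n, e ∉ innerEdges n →
      (e ∈ filledEdges t n ∪ T ↔ Filled t n e) := fun e h1 h2 => by
    rw [mem_union, mem_filledEdges]
    exact ⟨fun h => h.elim (fun h => h.2.2) fun h => absurd (hTi h) h2, fun h => Or.inl ⟨h1, h2, h⟩⟩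
  rw [lowerEdges, upperEdges,
    ← sum_triangleEdges lower_edgeFamilies true (lowerVertex g) a (filledEdges t n ∪ T),
    ← sum_triangleEdges (upper_edgeFamilies n) false (upperVertex g n) b (filledEdges t n ∪ T),
    sum_mul_sum]
  · refine sum_congr rfl fun TL hTL => sum_congr rfl fun TU hTU => ?_
    rw [mem_powerset] at hTL hTU
    -- The common outer edges of the two triangles have height 2a + 2. Inner edges of the lower
    -- triangle lie strictly below this level and those of the upper triangle strictly above, so
    -- neither product sees the inner edges of the other triangle.
    have hl : ∀ e, height e ≤ 2 * a + 2 → (e ∈ filledEdges t n ∪ (T ∪ TL ∪ TU) ↔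
        e ∈ filledEdges t n ∪ T ∪ TL) := fun e he => by
      have : e ∉ TU := fun h => by
        have := height_of_mem_upperEdges (hTU h)
        omega
      simp only [mem_union, this, or_false, or_assoc]
    have hu : ∀ e, 2 * a + 2 ≤ height e → (e ∈ filledEdges t n ∪ (T ∪ TL ∪ TU) ↔
        e ∈ filledEdges t n ∪ T ∪ TU) := fun e he => by
      have : e ∉ TL := fun h => by
        have := height_of_mem_lowerEdges (hTL h)
        omega
      simp only [mem_union, this, or_false, or_assoc]
    rw [prod_siteWeight g hcut.1 (by omega) hab]
    refine congr_arg₂ (· * ·) ?_ ?_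
    · refine prod_congr rfl fun j hj => prod_congr rfl fun i hi => ?_
      rw [mem_range] at hi hj
      refine layerWeight_congr (fun e => height e ≤ 2 * a + 2) hl ?_ ?_ ?_ ?_ ?_ ?_ <;>
        simp only [height, lowerLeft, lowerRight, lowerDiag] <;> push_cast <;> omega
    · refine prod_congr rfl fun j hj => prod_congr rfl fun i hi => ?_
      rw [mem_range] at hi hj
      refine layerWeight_congr (fun e => 2 * a + 2 ≤ height e) hu ?_ ?_ ?_ ?_ ?_ ?_ <;>
        simp only [height, upperLeft, upperRight, upperDiag] <;> push_cast <;> omega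
  · exact disjoint_union_left.2 ⟨disjoint_left.2 fun e he h => hF e he
      (upperEdges_subset (by omega) h), disjoint_of_subset_left hT hgu⟩
  · intro j hj hjb
    simp only [occ, decide_eq_false_iff_not]
    refine ⟨?_, ?_, ?_, ?_⟩ <;> rw [hocc] <;>
      simp only [upperLeft, upperRight, upperDiag, Filled, mem_edges_horizontal,
        mem_edges_vertical, mem_edges_diagonal, mem_innerEdges_horizontal,
        mem_innerEdges_vertical, mem_innerEdges_diagonal] <;> omega
  · exact disjoint_union_left.2 ⟨disjoint_left.2 fun e he h => hF e he
      (lowerEdges_subset hcut.1 h), disjoint_of_subset_left hT hgl⟩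
  · intro j hj hjb
    simp only [occ, decide_eq_true_eq]
    refine ⟨?_, ?_, ?_, ?_⟩ <;> rw [hocc] <;>
      simp only [lowerLeft, lowerRight, lowerDiag, Filled, mem_edges_horizontal,
        mem_edges_vertical, mem_edges_diagonal, mem_innerEdges_horizontal,
        mem_innerEdges_vertical, mem_innerEdges_diagonal] <;> omega

/-- The spectral parameter: it is `t` in the last column and `1` in the others. -/
noncomputable def columnParam (n : ℕ) (t : ℝ) (x : ℤ) : ℝ := if x = n then t else 1

theorem columnParam_pos {n : ℕ} {t : ℝ} (ht : 0 < t) (x : ℤ) : 0 < columnParam n t x := by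
  unfold columnParam
  split <;> linarith

/-- The inhomogeneous 20V vertex. -/
noncomputable def vertex20At (n : ℕ) (t : ℝ) (x : ℤ) (w s n' e : Bool) : Matrix Bool Bool ℝ :=
  vertex20 (columnParam n t x) w s n' e

/-- The inhomogeneous 6V vertex, crossed by a diagonal line without interaction. -/
noncomputable def vertex6At (n : ℕ) (t : ℝ) (x : ℤ) (w s n' e : Bool) : Matrix Bool Bool ℝ :=
  crossHV (columnParam n t x) w s n' e • 1

/-- The line of `vertex20` passes to the Northeast of the crossing, which is the outer side here, so
`vertex20` is literally a vertex followed by a line. Horizontal lines are indexed by `A` and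
vertical ones by `B`; the frozen state is that of the occupied West and South boundaries. -/
theorem trianglePF_lower (n : ℕ) {t : ℝ} (ht : 0 < t) (k : ℕ) (p q : Fin k → Bool) :
    trianglePF (lowerVertex (vertex20At n t)) true k p q =
      trianglePF (lowerVertex (vertex6At n t)) true k p q := by
  refine trianglePF_vertexThenLine true
    (fun _ i => crossHV (columnParam n t ((i : ℤ) + 1))) (fun _ => crossHD)
    (fun i s n' => crossVD (columnParam n t ((i : ℤ) + 1)) n' s) ⟨?_, ?_⟩ ?_ k p q
  · intro j l' d
    cases l' <;> cases d <;> simp [crossHD, crossing]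
  · intro i r' d
    cases r' <;> cases d <;> simp [crossVD, crossing]
  · intro k i _ l r p q
    exact vertex20_eq (columnParam_pos ht _) l r p q

/-- Here the outer side is the Southwest, so vertical and horizontal lines exchange the roles of `A`
and `B`, and the Yang-Baxter equation is first needed to put the line on the outer side. The frozen
state is that of the empty North and East boundaries. -/
theorem trianglePF_upper (n : ℕ) {t : ℝ} (ht : 0 < t) (k : ℕ) (p q : Fin k → Bool) :
    trianglePF (upperVertex (vertex20At n t) n) false k p q =
      trianglePF (upperVertex (vertex6At n t) n) false k p q := by
  have hc : ∀ {k i : ℕ}, i < k → (n : ℤ) - ((k - 1 - i : ℕ) : ℤ) = n - k + 1 + i := by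
    intro k i h
    omega
  rw [trianglePF_congr (G' := vertexThenLine
    (fun j i l r p q => crossHV (columnParam n t ((n : ℤ) - j + 1 + i)) p q l r)
    (fun j => crossVD (columnParam n t ((n : ℤ) - j))) (fun _ e w => crossHD w e))]
  · refine trianglePF_vertexThenLine false _ _ _ ⟨?_, ?_⟩ ?_ k p q
    · intro j l' d
      cases l' <;> cases d <;> simp [crossVD, crossing]
    · intro i r' d
      cases r' <;> cases d <;> simp [crossHD, crossing]
    · intro k i hi l r p q
      simp only [vertexThenLine, hc hi]
      exact (vertex20_eq (columnParam_pos ht _) p q l r).symm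
  · intro k i hi
    funext l r p q
    simp only [upperVertex, vertex20At, vertexThenLine, hc hi]
    exact vertex20_eq (columnParam_pos ht _) p q l r

/-- The diagonal lines can be removed from the 20V model. -/
theorem sum_vertex20_eq_sum_vertex6 (bc : DWBCType) {n : ℕ} (hn : 1 ≤ n) {t : ℝ} (ht : 0 < t) :
    ∑ S ∈ boundaryConfigs bc n, ∏ v ∈ grid n, siteWeight (vertex20At n t) S v =
      ∑ S ∈ boundaryConfigs bc n, ∏ v ∈ grid n, siteWeight (vertex6At n t) S v := by
  have hab : cut bc n + (2 * n - 1 - cut bc n) + 1 = 2 * n := by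
    cases bc <;> simp only [cut] <;> omega
  rw [sum_boundaryConfigs_eq _ bc hn rfl hab, sum_boundaryConfigs_eq _ bc hn rfl hab]
  simp only [trianglePF_lower n ht, trianglePF_upper n ht]

end Gluing

/-! ### The ice rule as conservation of path steps -/

section IceRule

variable {L : Finset Step} {n : ℕ} {S : Finset Edge}

theorem mem_edges_of_tail {v : ℤ × ℤ} (hv : v ∈ grid n) {s : Step} (hs : s ∈ L) :
    (s, v) ∈ edges L n := by
  obtain ⟨x, y⟩ := v
  rw [edges, mem_filter, mem_product, mem_product]
  refine ⟨⟨hs, ?_⟩, Or.inl hv⟩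
  rw [mem_grid] at hv
  simp only [mem_Icc]
  omega

theorem mem_edges_of_head {v : ℤ × ℤ} (hv : v ∈ grid n) {s : Step} (hs : s ∈ L) :
    (s, v - s.vec) ∈ edges L n := by
  obtain ⟨x, y⟩ := v
  rw [edges, mem_filter, mem_product, mem_product]
  refine ⟨⟨hs, ?_⟩, Or.inr (by simpa [head] using hv)⟩
  rw [mem_grid] at hv
  cases s <;> simp only [mem_Icc, Step.vec, Prod.mk_sub_mk] <;> omega

theorem head_eq_iff {s : Step} {u v : ℤ × ℤ} : head (s, u) = v ↔ u = v - s.vec := by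
  rw [head, eq_sub_iff_add_eq]

theorem vec_ne_zero (s : Step) : s.vec ≠ 0 := by cases s <;> simp [Step.vec]

theorem card_pointingIn {v : ℤ × ℤ} (hv : v ∈ grid n) :
    (pointingIn L n S v).card =
      (L.filter fun s => (s, v - s.vec) ∈ S).card + (L.filter fun s => (s, v) ∉ S).card := by
  have : pointingIn L n S v =
      ((L.filter fun s => (s, v - s.vec) ∈ S).image fun s => (s, v - s.vec)) ∪
      ((L.filter fun s => (s, v) ∉ S).image fun s => (s, v)) := by
    ext ⟨s, u⟩
    rw [pointingIn, mem_filter, mem_union, mem_image, mem_image, head_eq_iff]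
    simp only [mem_filter, Prod.mk.injEq, tail]
    constructor
    · rintro ⟨he, ⟨h1, rfl⟩ | ⟨h1, rfl⟩⟩
      · rw [edges, mem_filter, mem_product] at he
        exact Or.inl ⟨s, ⟨he.1.1, h1⟩, rfl, rfl⟩
      · rw [edges, mem_filter, mem_product] at he
        exact Or.inr ⟨s, ⟨he.1.1, h1⟩, rfl, rfl⟩
    · rintro (⟨s, ⟨h1, h2⟩, rfl, rfl⟩ | ⟨s, ⟨h1, h2⟩, rfl, rfl⟩)
      · exact ⟨mem_edges_of_head hv h1, Or.inl ⟨h2, rfl⟩⟩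
      · exact ⟨mem_edges_of_tail hv h1, Or.inr ⟨h2, rfl⟩⟩
  rw [this, card_union_of_disjoint, card_image_of_injective, card_image_of_injective]
  · exact fun a b h => (Prod.mk.inj h).1
  · exact fun a b h => (Prod.mk.inj h).1
  · simp only [disjoint_left, mem_image, mem_filter]
    rintro _ ⟨s, -, rfl⟩ ⟨s', -, h⟩
    obtain ⟨rfl, h⟩ := Prod.mk.inj h
    exact vec_ne_zero s' (sub_eq_self.1 h.symm)

theorem card_pointingOut {v : ℤ × ℤ} (hv : v ∈ grid n) :
    (pointingOut L n S v).card =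
      (L.filter fun s => (s, v - s.vec) ∉ S).card + (L.filter fun s => (s, v) ∈ S).card := by
  have : pointingOut L n S v =
      ((L.filter fun s => (s, v - s.vec) ∉ S).image fun s => (s, v - s.vec)) ∪
      ((L.filter fun s => (s, v) ∈ S).image fun s => (s, v)) := by
    ext ⟨s, u⟩
    rw [pointingOut, mem_filter, mem_union, mem_image, mem_image, head_eq_iff]
    simp only [mem_filter, Prod.mk.injEq, tail]
    constructor
    · rintro ⟨he, ⟨h1, rfl⟩ | ⟨h1, rfl⟩⟩
      · rw [edges, mem_filter, mem_product] at he
        exact Or.inr ⟨s, ⟨he.1.1, h1⟩, rfl, rfl⟩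
      · rw [edges, mem_filter, mem_product] at he
        exact Or.inl ⟨s, ⟨he.1.1, h1⟩, rfl, rfl⟩
    · rintro (⟨s, ⟨h1, h2⟩, rfl, rfl⟩ | ⟨s, ⟨h1, h2⟩, rfl, rfl⟩)
      · exact ⟨mem_edges_of_head hv h1, Or.inr ⟨h2, rfl⟩⟩
      · exact ⟨mem_edges_of_tail hv h1, Or.inl ⟨h2, rfl⟩⟩
  rw [this, card_union_of_disjoint, card_image_of_injective, card_image_of_injective]
  · exact fun a b h => (Prod.mk.inj h).1
  · exact fun a b h => (Prod.mk.inj h).1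
  · simp only [disjoint_left, mem_image, mem_filter]
    rintro _ ⟨s, -, rfl⟩ ⟨s', -, h⟩
    obtain ⟨rfl, h⟩ := Prod.mk.inj h
    exact vec_ne_zero s' (sub_eq_self.1 h.symm)

/-- The ice rule is the conservation of the number of path steps. -/
theorem iceRule_iff : IceRule L n S ↔ ∀ v ∈ grid n,
    (L.filter fun s => (s, v - s.vec) ∈ S).card = (L.filter fun s => (s, v) ∈ S).card := by
  refine forall₂_congr fun v hv => ?_
  rw [card_pointingIn hv, card_pointingOut hv]
  have h1 := card_filter_add_card_filter_not (s := L) fun s => (s, v - s.vec) ∈ S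
  have h2 := card_filter_add_card_filter_not (s := L) fun s => (s, v) ∈ S
  omega

/-- This weak form of conservation is all that the analysis of the uppermost path needs, and it has
the same shape for the 6V and the 20V model. -/
theorem exists_head_iff_exists_tail (hS : S ⊆ edges L n) (h : IceRule L n S) {v : ℤ × ℤ}
    (hv : v ∈ grid n) : (∃ e ∈ S, head e = v) ↔ ∃ e ∈ S, tail e = v := by
  have hL : ∀ {e}, e ∈ S → e.1 ∈ L := fun he => by
    have := hS he
    rw [edges, mem_filter, mem_product] at this
    exact this.1.1
  have h1 : (∃ e ∈ S, head e = v) ↔ (L.filter fun s => (s, v - s.vec) ∈ S).Nonempty := by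
    constructor
    · rintro ⟨⟨s, u⟩, he, h'⟩
      rw [head_eq_iff] at h'
      exact ⟨s, mem_filter.2 ⟨hL he, h' ▸ he⟩⟩
    · rintro ⟨s, hs⟩
      exact ⟨_, (mem_filter.1 hs).2, head_eq_iff.2 rfl⟩
  have h2 : (∃ e ∈ S, tail e = v) ↔ (L.filter fun s => (s, v) ∈ S).Nonempty := by
    constructor
    · rintro ⟨⟨s, u⟩, he, rfl⟩
      exact ⟨s, mem_filter.2 ⟨hL he, he⟩⟩
    · rintro ⟨s, hs⟩
      exact ⟨_, (mem_filter.1 hs).2, rfl⟩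
  rw [h1, h2, ← card_pos, ← card_pos, iceRule_iff.1 h v hv]

end IceRule

/-! ### The uppermost path and the row where it reaches the last column -/

section TopPath

/-- What the uppermost path needs to know about a configuration. -/
structure PathSystem (n : ℕ) (S : Finset Edge) : Prop where
  subset : S ⊆ edges triangularSteps n
  conserve : ∀ v ∈ grid n, (∃ e ∈ S, head e = v) ↔ ∃ e ∈ S, tail e = v
  north : ∀ x : ℤ, 1 ≤ x → x ≤ n → (Step.vertical, (x, (n : ℤ) + 1)) ∉ S
  northDiag : ∀ x : ℤ, 1 ≤ x → x ≤ n → (Step.diagonal, (x, (n : ℤ) + 1)) ∉ S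
  south : ∀ x : ℤ, 1 ≤ x → x ≤ n → (Step.vertical, (x, 1)) ∈ S

variable {n : ℕ} {S : Finset Edge}

/-- In a column that no path enters above row `y₀`, nothing happens above this row. -/
theorem PathSystem.column_empty (hS : PathSystem n S) {x y₀ : ℤ} (hx : 1 ≤ x) (hxn : x ≤ n)
    (hy₀ : 0 ≤ y₀) (hH : ∀ y, y₀ < y → (Step.horizontal, (x - 1, y)) ∉ S)
    (hD : ∀ y, y₀ < y → (Step.diagonal, (x - 1, y + 1)) ∉ S) (m : ℕ) :
    ∀ y, y₀ < y → n + 1 - m ≤ y → ∀ s, (s, (x, y)) ∉ S := by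
  induction m with
  | zero =>
    intro y hy hyn s hs
    have he := hS.subset hs
    cases s
    · rw [mem_edges_horizontal] at he
      push_cast at hyn
      omega
    · rw [mem_edges_vertical] at he
      obtain rfl : y = n + 1 := by push_cast at hyn; omega
      exact hS.north x hx hxn hs
    · rw [mem_edges_diagonal] at he
      obtain rfl : y = n + 1 := by push_cast at hyn; omega
      exact hS.northDiag x hx hxn hs
  | succ m ih =>
    intro y hy hyn s hs
    push_cast at hyn
    by_cases h : (n : ℤ) + 1 - m ≤ y
    · exact ih y hy h s hs
    by_cases hyn' : y ≤ n
    · obtain ⟨⟨s', u⟩, he, hu⟩ := (hS.conserve (x, y) (mem_grid.2 (by omega))).2 ⟨_, hs, rfl⟩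
      obtain rfl := head_eq_iff.1 hu
      cases s'
      · exact hH y hy (by simpa [Step.vec] using he)
      · exact ih (y + 1) (by omega) (by omega) _ (by simpa [Step.vec] using he)
      · exact hD y hy (by simpa [Step.vec] using he)
    · omega

/-- The step `e` belongs to the uppermost path: no path step enters the end point of `e` above
`e`, no path leaves the column of this point above it, and no path enters the column above `e`. -/
structure IsTop (n : ℕ) (S : Finset Edge) (e : Edge) : Prop where
  mem : e ∈ S
  head_mem : head e ∈ grid n
  inRank : inRank S e = 0
  leave : ∀ f ∈ S, f.1 ≠ .vertical → (tail f).1 = (head e).1 → (tail f).2 ≤ (head e).2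
  enter : e.1 ≠ .vertical →
    ∀ f ∈ S, f.1 ≠ .vertical → (head f).1 = (head e).1 → (head f).2 ≤ (head e).2

theorem outRank_eq_zero_iff {e : Edge} :
    outRank S e = 0 ↔ ∀ f ∈ S, tail f = tail e → e.1.outPos ≤ f.1.outPos := by
  simp [outRank, filter_eq_empty_iff]

theorem inRank_eq_zero_iff {e : Edge} :
    inRank S e = 0 ↔ ∀ f ∈ S, head f = head e → e.1.inPos ≤ f.1.inPos := by
  simp [inRank, filter_eq_empty_iff]

theorem IsTop.exists_follows (hS : PathSystem n S) {e : Edge} (he : IsTop n S e) :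
    ∃ e', Follows S e e' := by
  obtain ⟨f, hf, hfe⟩ := (hS.conserve _ he.head_mem).1 ⟨e, he.mem, rfl⟩
  obtain ⟨e', he', hmin⟩ := exists_min_image (S.filter fun f => tail f = head e)
    (fun f => f.1.outPos) ⟨f, mem_filter.2 ⟨hf, hfe⟩⟩
  rw [mem_filter] at he'
  refine ⟨e', he.mem, he'.1, he'.2, ?_⟩
  rw [he.inRank, eq_comm, outRank_eq_zero_iff]
  exact fun f hf h => hmin f (mem_filter.2 ⟨hf, h.trans he'.2⟩)

/-- The step after a step of the uppermost path belongs to the uppermost path. -/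
theorem IsTop.next (hS : PathSystem n S) {e e' : Edge} (he : IsTop n S e)
    (hlt : (head e).1 < n) (h : Follows S e e') : IsTop n S e' := by
  obtain ⟨-, he', ht, hr⟩ := h
  rw [he.inRank, eq_comm, outRank_eq_zero_iff] at hr
  have hg := he.head_mem
  have hleave := he.leave
  rw [← ht] at hlt hg hleave
  obtain ⟨s, x, y⟩ := e'
  simp only [tail] at hlt hg hleave hr
  rw [mem_grid] at hg
  have hH : ∀ z, y < z → (Step.horizontal, (x, z)) ∉ S := fun z hz hm => by
    have := hleave _ hm (by simp) rfl
    simp only at this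
    omega
  have hD : ∀ z, y < z → (Step.diagonal, (x, z)) ∉ S := fun z hz hm => by
    have := hleave _ hm (by simp) rfl
    simp only at this
    omega
  -- No step leaves column x above the path, so column x + 1 is empty above the row y₀: y₀ = y after
  -- a horizontal step, y₀ = y - 1 after a diagonal one, since the vertex also has no horizontal
  -- exit then.
  have hempty : ∀ y₀, 0 ≤ y₀ → (∀ z, y₀ < z → (Step.horizontal, (x, z)) ∉ S) →
      (∀ z, y₀ < z → (Step.diagonal, (x, z + 1)) ∉ S) → ∀ z, y₀ < z → ∀ s, (s, (x + 1, z)) ∉ S :=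
    fun y₀ h0 h1 h2 z hz => hS.column_empty (by omega) (by omega) h0
      (by simpa using h1) (by simpa using h2) (n + 1) z hz (by push_cast; omega)
  cases s
  · have hemp := hempty y (by omega) hH (fun z hz => hD _ (by omega))
    refine ⟨he', ?_, ?_, ?_, ?_⟩
    · simp only [head, Step.vec, Prod.mk_add_mk, mem_grid]
      omega
    · rw [inRank_eq_zero_iff]
      rintro ⟨s, u⟩ hf hu
      rw [head_eq_iff] at hu
      simp only [head, Step.vec, Prod.mk_add_mk] at hu
      cases s
      · simp
      · simp only [Prod.mk_sub_mk] at hu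
        subst hu
        exact absurd hf (by simpa using hemp (y + 1) (by omega) _)
      · simp only [Prod.mk_sub_mk] at hu
        subst hu
        exact absurd hf (by simpa using hD (y + 1) (by omega))
    · rintro ⟨s, u, z⟩ hf - hu
      simp only [tail, head, Step.vec, Prod.mk_add_mk] at hu ⊢
      subst hu
      by_contra hlt
      exact hemp z (by omega) _ hf
    · rintro - ⟨s, u, z⟩ hf hs hu
      cases s
      · simp only [head, Step.vec, Prod.mk_add_mk] at hu ⊢
        obtain rfl : u = x := by omega
        by_contra hlt
        exact hH z (by omega) hf
      · exact absurd rfl hs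
      · simp only [head, Step.vec, Prod.mk_add_mk] at hu ⊢
        obtain rfl : u = x := by omega
        by_contra hlt
        exact hD z (by omega) hf
  · have hH' : (Step.horizontal, (x, y)) ∉ S := fun hm => by
      simpa [Step.outPos] using hr _ hm rfl
    have hD' : (Step.diagonal, (x, y)) ∉ S := fun hm => by
      simpa [Step.outPos] using hr _ hm rfl
    have hH2 : ∀ z, y ≤ z → (Step.horizontal, (x, z)) ∉ S := fun z hz =>
      hz.eq_or_lt.elim (fun h => h ▸ hH') (hH z)
    have hD2 : ∀ z, y ≤ z → (Step.diagonal, (x, z)) ∉ S := fun z hz =>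
      hz.eq_or_lt.elim (fun h => h ▸ hD') (hD z)
    refine ⟨he', ?_, ?_, ?_, fun h => absurd rfl h⟩
    · simp only [head, Step.vec, Prod.mk_add_mk, mem_grid]
      -- If the uppermost path left the grid through the South before the last column, nothing would
      -- enter column x + 1, although its South boundary edge carries a step.
      suffices y ≠ 1 by omega
      rintro rfl
      exact hempty 0 le_rfl (fun z hz => hH2 z (by omega)) (fun z hz => hD2 _ (by omega)) 1
        (by omega) _ (hS.south (x + 1) (by omega) (by omega))
    · rw [inRank_eq_zero_iff]
      intro f _ _
      simp [Step.inPos]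
    · rintro ⟨s, u, z⟩ hf hs hu
      simp only [tail, head, Step.vec, Prod.mk_add_mk, add_zero] at hu ⊢
      subst hu
      by_contra hlt
      cases s
      · exact hH2 z (by omega) hf
      · exact absurd rfl hs
      · exact hD2 z (by omega) hf
  · have hH' : (Step.horizontal, (x, y)) ∉ S := fun hm => by
      simpa [Step.outPos] using hr _ hm rfl
    have hH2 : ∀ z, y ≤ z → (Step.horizontal, (x, z)) ∉ S := fun z hz =>
      hz.eq_or_lt.elim (fun h => h ▸ hH') (hH z)
    have hemp := hempty (y - 1) (by omega) (fun z hz => hH2 z (by omega))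
      (fun z hz => hD _ (by omega))
    refine ⟨he', ?_, ?_, ?_, ?_⟩
    · simp only [head, Step.vec, Prod.mk_add_mk, mem_grid]
      -- The same contradiction with the South boundary, now for a diagonal exit.
      suffices y ≠ 1 by omega
      rintro rfl
      exact hemp 1 (by omega) _ (hS.south (x + 1) (by omega) (by omega))
    · rw [inRank_eq_zero_iff]
      rintro ⟨s, u⟩ hf hu
      rw [head_eq_iff] at hu
      simp only [head, Step.vec, Prod.mk_add_mk] at hu
      cases s
      · simp [Step.inPos]
      · simp only [Prod.mk_sub_mk] at hu
        subst hu
        exact absurd hf (by simpa using hemp y (by omega) _)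
      · simp
    · rintro ⟨s, u, z⟩ hf - hu
      simp only [tail, head, Step.vec, Prod.mk_add_mk] at hu ⊢
      subst hu
      by_contra hlt
      exact hemp z (by omega) _ hf
    · rintro - ⟨s, u, z⟩ hf hs hu
      cases s
      · simp only [head, Step.vec, Prod.mk_add_mk] at hu ⊢
        obtain rfl : u = x := by omega
        by_contra hlt
        exact hH2 z (by omega) hf
      · exact absurd rfl hs
      · simp only [head, Step.vec, Prod.mk_add_mk] at hu ⊢
        obtain rfl : u = x := by omega
        by_contra hlt
        exact hD z (by omega) hf

theorem tail_fst_le_head_fst (e : Edge) : (tail e).1 ≤ (head e).1 := by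
  obtain ⟨s, x, y⟩ := e
  cases s <;> simp [tail, head, Step.vec]

/-- Being uppermost propagates only up to the arrival in the last column, which is what the bound on
the starting point of the step expresses. -/
theorem IsTop.of_reachable (hS : PathSystem n S) {e₀ : Edge} (h₀ : IsTop n S e₀) {e : Edge}
    (h : Relation.ReflTransGen (Follows S) e₀ e) (ht : (tail e).1 < n) : IsTop n S e := by
  induction h with
  | refl => exact h₀
  | @tail b c _ hbc ih =>
    rw [hbc.2.2.1] at ht
    exact (ih ((tail_fst_le_head_fst b).trans_lt ht)).next hS ht hbc

/-- Each step lowers n - x + y by 1 or 2, and the uppermost path stays in the grid until it reaches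
the last column. -/
theorem IsTop.exists_hit (hS : PathSystem n S) (m : ℕ) : ∀ {e : Edge}, IsTop n S e →
    (tail e).1 < n → ((n : ℤ) - (head e).1 + (head e).2).toNat ≤ m → ∃ ℓ ∈ Icc 1 n,
      FirstHitsLastColumnAt n S e ℓ := by
  induction m with
  | zero =>
    intro e he _ hm
    have := he.head_mem
    rw [← Prod.mk.eta (p := head e), mem_grid] at this
    omega
  | succ m ih =>
    intro e he ht hm
    have hg := he.head_mem
    rw [← Prod.mk.eta (p := head e), mem_grid] at hg
    by_cases hlt : (head e).1 < n
    · obtain ⟨e', hf⟩ := he.exists_follows hS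
      have he' := he.next hS hlt hf
      have ht' := hf.2.2.1
      obtain ⟨ℓ, hℓ, e'', h1, h2⟩ := ih he' (by rw [ht']; exact hlt) (by
        rw [← ht'] at hm hg
        obtain ⟨s, x, y⟩ := e'
        cases s <;> simp only [tail, head, Step.vec, Prod.mk_add_mk] at hm hg ⊢ <;> omega)
      exact ⟨ℓ, hℓ, e'', Relation.ReflTransGen.head hf h1, h2⟩
    · refine ⟨(head e).2.toNat, by rw [mem_Icc]; omega, e, .refl, ht, ?_⟩
      ext <;> simp only <;> omega

/-- The row where the uppermost path hits the last column is the highest one where a path enters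
this column. -/
theorem FirstHitsLastColumnAt.enter (hS : PathSystem n S) {e₀ : Edge} (h₀ : IsTop n S e₀) {ℓ : ℕ}
    (h : FirstHitsLastColumnAt n S e₀ ℓ) :
    (1 ≤ ℓ ∧ ℓ ≤ n) ∧ ((Step.horizontal, ((n : ℤ) - 1, (ℓ : ℤ))) ∈ S ∨
      (Step.diagonal, ((n : ℤ) - 1, (ℓ : ℤ) + 1)) ∈ S) ∧
    (∀ y : ℤ, ℓ < y → (Step.horizontal, ((n : ℤ) - 1, y)) ∉ S) ∧
    ∀ y : ℤ, ℓ < y → (Step.diagonal, ((n : ℤ) - 1, y + 1)) ∉ S := by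
  obtain ⟨e, hr, ht, hh⟩ := h
  have he := IsTop.of_reachable hS h₀ hr ht
  have hg := he.head_mem
  have hent := he.enter
  have hmem := he.mem
  rw [hh, mem_grid] at hg
  rw [hh] at hent
  rw [← Prod.mk.eta (p := e), head_eq_iff] at hh
  obtain ⟨s, u⟩ := e
  simp only at hh
  subst hh
  have hs : s ≠ .vertical := by
    rintro rfl
    simp [tail, Step.vec] at ht
  refine ⟨by omega, ?_, fun y hy hm => ?_, fun y hy hm => ?_⟩
  · cases s
    · exact Or.inl (by simpa [Step.vec] using hmem)
    · exact absurd rfl hs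
    · exact Or.inr (by simpa [Step.vec] using hmem)
  · have := hent hs _ hm (by simp) (by simp [head, Step.vec])
    simp only [head, Step.vec, Prod.mk_add_mk] at this
    omega
  · have := hent hs _ hm (by simp) (by simp [head, Step.vec])
    simp only [head, Step.vec, Prod.mk_add_mk] at this
    omega

/-- Both rows are the highest one in which any path enters the last column. -/
theorem FirstHitsLastColumnAt.unique (hS : PathSystem n S) {e₀ : Edge} (h₀ : IsTop n S e₀)
    {ℓ ℓ' : ℕ} (h : FirstHitsLastColumnAt n S e₀ ℓ) (h' : FirstHitsLastColumnAt n S e₀ ℓ') :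
    ℓ = ℓ' := by
  obtain ⟨-, h1, h2, h3⟩ := h.enter hS h₀
  obtain ⟨-, h1', h2', h3'⟩ := h'.enter hS h₀
  apply le_antisymm <;> by_contra hlt
  · exact h1.elim (h2' _ (by omega)) (h3' _ (by omega))
  · exact h1'.elim (h2 _ (by omega)) (h3 _ (by omega))

end TopPath

/-! ### The weight of a 20V configuration with parameter t in the last column -/

section Configurations

variable {n : ℕ} {S : Finset Edge}

theorem mem_edges_iff {L : Finset Step} {e : Edge} :
    e ∈ edges L n ↔ e.1 ∈ L ∧ e ∈ edges triangularSteps n := by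
  rw [edges, edges, mem_filter, mem_filter, mem_product (s := L),
    mem_product (s := triangularSteps)]
  have : e.1 ∈ triangularSteps := by
    rw [triangularSteps]
    cases e.1 <;> simp
  tauto

theorem iceRule_triangular : IceRule triangularSteps n S ↔ ∀ x y : ℤ, (x, y) ∈ grid n →
    (occ S (Step.horizontal, (x - 1, y))).toNat + (occ S (Step.vertical, (x, y + 1))).toNat +
      (occ S (Step.diagonal, (x - 1, y + 1))).toNat =
    (occ S (Step.horizontal, (x, y))).toNat + (occ S (Step.vertical, (x, y))).toNat +
      (occ S (Step.diagonal, (x, y))).toNat := by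
  have key : ∀ (p : Step → Prop) [DecidablePred p], (triangularSteps.filter p).card =
      (decide (p .horizontal)).toNat + (decide (p .vertical)).toNat +
        (decide (p .diagonal)).toNat := by
    intro p _
    rw [triangularSteps, filter_insert, filter_insert, filter_singleton]
    split_ifs <;> simp_all
  rw [iceRule_iff, Prod.forall]
  refine forall₃_congr fun x y _ => ?_
  rw [key, key]
  simp only [occ, Step.vec, Prod.mk_sub_mk, sub_zero, sub_neg_eq_add]

theorem iceRule_square : IceRule squareSteps n S ↔ ∀ x y : ℤ, (x, y) ∈ grid n →
    (occ S (Step.horizontal, (x - 1, y))).toNat + (occ S (Step.vertical, (x, y + 1))).toNat =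
    (occ S (Step.horizontal, (x, y))).toNat + (occ S (Step.vertical, (x, y))).toNat := by
  have key : ∀ (p : Step → Prop) [DecidablePred p], (squareSteps.filter p).card =
      (decide (p .horizontal)).toNat + (decide (p .vertical)).toNat := by
    intro p _
    rw [squareSteps, filter_insert, filter_singleton]
    split_ifs <;> simp_all
  rw [iceRule_iff, Prod.forall]
  refine forall₃_congr fun x y _ => ?_
  rw [key, key]
  simp only [occ, Step.vec, Prod.mk_sub_mk, sub_zero, sub_neg_eq_add]

theorem mem_configs20V {bc : DWBCType} : S ∈ configs20V bc n ↔ S ⊆ edges triangularSteps n ∧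
    IceRule triangularSteps n S ∧ BoundaryCondition bc n S := by
  classical
  simp only [configs20V, mem_filter, mem_powerset, BoundaryCondition]

theorem mem_configs6V : S ∈ configs6V n ↔ S ⊆ edges squareSteps n ∧
    IceRule squareSteps n S ∧ SquareDWBC n S := by
  classical
  simp only [configs6V, mem_filter, mem_powerset]

theorem pathSystem_of_mem_configs20V {bc : DWBCType} (hS : S ∈ configs20V bc n) :
    PathSystem n S := by
  obtain ⟨h1, h2, h3⟩ := mem_configs20V.1 hS
  by_cases hn : n = 0
  · subst hn
    exact ⟨h1, fun v hv => exists_head_iff_exists_tail h1 h2 hv, fun x _ _ => by push_cast at *; omega,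
      fun x _ _ => by push_cast at *; omega, fun x _ _ => by push_cast at *; omega⟩
  refine ⟨h1, fun v hv => exists_head_iff_exists_tail h1 h2 hv,
    fun x hx hxn => h3.1.2.2.2 x (mem_Icc.2 ⟨hx, hxn⟩), fun x hx hxn h => ?_,
    fun x hx hxn => h3.1.2.1 x (mem_Icc.2 ⟨hx, hxn⟩)⟩
  have := mem_edges_diagonal.1 (h1 h)
  exact h3.2.1.2.2.2 x (mem_Icc.2 (by omega)) h

theorem pathSystem_of_mem_configs6V (hS : S ∈ configs6V n) : PathSystem n S := by
  obtain ⟨h1, h2, h3⟩ := mem_configs6V.1 hS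
  refine ⟨fun e he => (mem_edges_iff.1 (h1 he)).2,
    fun v hv => exists_head_iff_exists_tail h1 h2 hv,
    fun x hx hxn => h3.2.2.2 x (mem_Icc.2 ⟨hx, hxn⟩), fun x hx hxn h => ?_,
    fun x hx hxn => h3.2.1 x (mem_Icc.2 ⟨hx, hxn⟩)⟩
  simpa [squareSteps] using (mem_edges_iff.1 (h1 h)).1

/-- A horizontal first step is uppermost only if no path comes in through the upper left corner
edge; this is why the two types need different starting edges. -/
theorem PathSystem.isTop (hS : PathSystem n S) (hn : 1 ≤ n) {e : Edge} (he : e ∈ S)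
    (hh : head e = (1, (n : ℤ)))
    (hd : (Step.diagonal, (0, (n : ℤ) + 1)) ∈ S → e.1 ≠ .horizontal) : IsTop n S e := by
  refine ⟨he, ?_, ?_, ?_, ?_⟩
  · rw [hh, mem_grid]
    omega
  · rw [inRank_eq_zero_iff]
    rintro ⟨s, u⟩ hf hu
    rw [hh, head_eq_iff] at hu
    subst hu
    cases s
    · cases e.1 <;> simp [Step.inPos]
    · exact absurd hf (by simpa [Step.vec] using hS.north 1 le_rfl (by omega))
    · have := hd (by simpa [Step.vec] using hf)
      revert this
      cases e.1 <;> simp [Step.inPos]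
  · rintro ⟨s, x, y⟩ hf hs hx
    rw [hh] at hx ⊢
    simp only [tail] at hx ⊢
    subst hx
    have := hS.subset hf
    cases s
    · exact (mem_edges_horizontal.1 this).2.2.2.2
    · exact absurd rfl hs
    · have h1 := mem_edges_diagonal.1 this
      by_contra hlt
      obtain rfl : y = n + 1 := by omega
      exact hS.northDiag 1 le_rfl (by omega) hf
  · rintro - ⟨s, x, y⟩ hf hs hx
    rw [hh] at hx ⊢
    have := hS.subset hf
    cases s
    · have h1 := mem_edges_horizontal.1 this
      simp only [head, Step.vec, Prod.mk_add_mk]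
      omega
    · exact absurd rfl hs
    · have h1 := mem_edges_diagonal.1 this
      simp only [head, Step.vec, Prod.mk_add_mk]
      omega

theorem isTop_topStart {bc : DWBCType} (hn : 1 ≤ n) (hS : S ∈ configs20V bc n) :
    IsTop n S (topStart n bc) := by
  obtain ⟨h1, h2, h3⟩ := mem_configs20V.1 hS
  cases bc
  · exact (pathSystem_of_mem_configs20V hS).isTop hn h3.2.2.1
      (by simp [topStart, upperLeftCorner, head, Step.vec]) (by simp [topStart, upperLeftCorner])
  · exact (pathSystem_of_mem_configs20V hS).isTop hn (h3.1.1 n (by rw [mem_Icc]; omega))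
      (by simp [topStart, upperWestEdge, head, Step.vec]) fun h => absurd h h3.2.2.1

theorem isTop_upperWestEdge (hn : 1 ≤ n) (hS : S ∈ configs6V n) :
    IsTop n S (upperWestEdge n) := by
  obtain ⟨h1, h2, h3⟩ := mem_configs6V.1 hS
  refine (pathSystem_of_mem_configs6V hS).isTop hn (h3.1 n (by rw [mem_Icc]; omega))
    (by simp [upperWestEdge, head, Step.vec]) fun h => ?_
  simpa [squareSteps] using (mem_edges_iff.1 (h1 h)).1

/-- Sorting configurations by the row where the uppermost path hits the last column. -/
theorem sum_eq_sum_hits {C : Finset (Finset Edge)} (hn : 1 ≤ n) (hC : ∀ S ∈ C, PathSystem n S)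
    (e : Edge) (he : (tail e).1 < 1) (hT : ∀ S ∈ C, IsTop n S e) (f : Finset Edge → ℝ) :
    ∑ S ∈ C, f S = ∑ ℓ ∈ Icc 1 n, open Classical in
      ∑ S ∈ C.filter fun S => FirstHitsLastColumnAt n S e ℓ, f S := by
  classical
  simp only [sum_filter]
  rw [sum_comm]
  refine sum_congr rfl fun S hS => ?_
  obtain ⟨ℓ, hℓ, h⟩ := IsTop.exists_hit (hC S hS) _ (hT S hS) (by omega) le_rfl
  rw [sum_eq_single ℓ]
  · rw [if_pos h]
  · intro ℓ' _ hne
    rw [if_neg fun h' => hne (h'.unique (hC S hS) (hT S hS) h)]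
  · exact fun h' => absurd hℓ h'

/-- The profile of the last column: one weight below row ℓ, a special one where the uppermost path
arrives, and 1 above. -/
theorem prod_Icc_int {R : Type*} [CommMonoid R] {m ℓ k : ℕ} (hm : m ≤ ℓ) (hk : ℓ ≤ k) {f : ℤ → R}
    {a c : R} (ha : ∀ y : ℤ, m ≤ y → y < ℓ → f y = a) (hc : f ℓ = c)
    (hd : ∀ y : ℤ, ℓ < y → y ≤ k → f y = 1) :
    ∏ y ∈ Icc (m : ℤ) k, f y = a ^ (ℓ - m) * c := by
  have h1 : Icc (m : ℤ) k = Ico (m : ℤ) ℓ ∪ ({(ℓ : ℤ)} ∪ Ioc (ℓ : ℤ) k) := by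
    ext y
    simp only [mem_Icc, mem_union, mem_Ico, mem_singleton, mem_Ioc]
    omega
  have h2 : Disjoint (Ico (m : ℤ) ℓ) ({(ℓ : ℤ)} ∪ Ioc (ℓ : ℤ) k) := by
    simp only [disjoint_left, mem_union, mem_Ico, mem_singleton, mem_Ioc]
    intro y
    omega
  have h3 : Disjoint ({(ℓ : ℤ)} : Finset ℤ) (Ioc (ℓ : ℤ) k) := by simp
  rw [h1, prod_union h2, prod_union h3, prod_singleton, hc,
    prod_congr rfl fun y hy => ha y (mem_Ico.1 hy).1 (mem_Ico.1 hy).2,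
    prod_congr rfl fun y hy => hd y (mem_Ioc.1 hy).1 (mem_Ioc.1 hy).2, prod_const, prod_const_one,
    mul_one, Int.card_Ico]
  congr 2
  omega

theorem prod_grid_eq_prod_last_column (hn : 1 ≤ n) {f : ℤ × ℤ → ℝ}
    (hf : ∀ x y : ℤ, (x, y) ∈ grid n → x ≠ n → f (x, y) = 1) :
    ∏ v ∈ grid n, f v = ∏ y ∈ Icc (1 : ℤ) n, f ((n : ℤ), y) := by
  rw [grid, prod_product, prod_eq_single (n : ℤ)]
  · intro x hx hxn
    exact prod_eq_one fun y hy => hf x y (mem_product.2 ⟨hx, hy⟩) hxn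
  · intro h
    rw [mem_Icc] at h
    omega

/-! The last column. -/

/-- The vertical edges of the last column are those that the uppermost path follows. -/
theorem occ_vertical_last (hP : PathSystem n S) {ℓ : ℕ} {e₀ : Edge} (h₀ : IsTop n S e₀)
    (hE : ∀ y : ℤ, (Step.horizontal, ((n : ℤ), y)) ∉ S)
    (hD : ∀ y : ℤ, 2 ≤ y → (Step.diagonal, ((n : ℤ), y)) ∉ S)
    (h : FirstHitsLastColumnAt n S e₀ ℓ) (y : ℤ) (hy : 1 ≤ y) :
    (Step.vertical, ((n : ℤ), y)) ∈ S ↔ y ≤ ℓ := by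
  obtain ⟨⟨hℓ, hℓn⟩, hin, hH, hD'⟩ := h.enter hP h₀
  have hout : ∀ z : ℤ, 1 ≤ z → z ≤ n → (∃ e ∈ S, head e = ((n : ℤ), z)) →
      (Step.vertical, ((n : ℤ), z)) ∈ S := by
    intro z hz hzn hex
    -- In row 1 a path may also leave through the lower right corner edge (BC1), so conservation
    -- does not decide; the South boundary condition does.
    obtain rfl | hz2 : z = 1 ∨ 2 ≤ z := by omega
    · exact hP.south n (by omega) le_rfl
    · obtain ⟨⟨s, u⟩, hs, rfl⟩ := (hP.conserve _ (mem_grid.2 (by omega))).1 hex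
      cases s
      · exact absurd hs (hE z)
      · exact hs
      · exact absurd hs (hD z hz2)
  constructor
  · intro hmem
    by_contra hlt
    exact hP.column_empty (by omega) le_rfl (by omega : (0 : ℤ) ≤ ℓ) hH hD' (n + 1) y
      (by omega) (by push_cast; omega) _ hmem
  · intro hyℓ
    obtain ⟨m, hm⟩ : ∃ m : ℕ, (ℓ : ℤ) - y = m := ⟨((ℓ : ℤ) - y).toNat, by omega⟩
    induction m generalizing y with
    | zero =>
      obtain rfl : y = ℓ := by push_cast at hm; omega
      refine hout _ hy (by omega) (hin.elim (fun h => ⟨_, h, ?_⟩) fun h => ⟨_, h, ?_⟩) <;>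
        simp [head, Step.vec]
    | succ m ih =>
      have := ih (y + 1) (by omega) (by push_cast at hm; omega) (by push_cast at hm; omega)
      exact hout _ hy (by omega) ⟨_, this, by simp [head, Step.vec]⟩

/-- The weight of the last column of a 20V configuration. -/
noncomputable def lastColumnWeight (bc : DWBCType) (t : ℝ) (ℓ : ℕ) : ℝ :=
  match bc with
  | .bc1 => if ℓ = 1 then 1 else t ^ (ℓ - 2) * ((1 + t) / 2)
  | .bc2 => t ^ (ℓ - 1)

theorem prod_siteWeight_vertex20 {bc : DWBCType} (hn : 1 ≤ n) {t : ℝ} (ht : 0 < t)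
    (hS : S ∈ configs20V bc n) {ℓ : ℕ} (h : FirstHitsLastColumnAt n S (topStart n bc) ℓ) :
    ∏ v ∈ grid n, siteWeight (vertex20At n t) S v = lastColumnWeight bc t ℓ * turnWeight t := by
  have hP := pathSystem_of_mem_configs20V hS
  have hT := isTop_topStart hn hS
  obtain ⟨h1, h2, h3⟩ := mem_configs20V.1 hS
  rw [iceRule_triangular] at h2
  rw [prod_grid_eq_prod_last_column hn]
  swap
  · intro x y hxy hx
    simp only [siteWeight, vertex20At, columnParam, if_neg hx, vertex20_one, h2 x y hxy]
    simp
  obtain ⟨⟨hℓ, hℓn⟩, -⟩ := h.enter hP hT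
  have hE : ∀ y : ℤ, (Step.horizontal, ((n : ℤ), y)) ∉ S := fun y hy =>
    h3.1.2.2.1 y (by have := mem_edges_horizontal.1 (h1 hy); rw [mem_Icc]; omega) hy
  have hD : ∀ y : ℤ, 2 ≤ y → (Step.diagonal, ((n : ℤ), y)) ∉ S := fun y hy2 hy => by
    have := mem_edges_diagonal.1 (h1 hy)
    exact h3.2.1.2.2.1 (y - 1) (by rw [mem_Icc]; omega) (by simpa using hy)
  have hV := occ_vertical_last hP hT hE hD h
  have hV' : ∀ y : ℤ, 1 ≤ y → occ S (Step.vertical, ((n : ℤ), y)) = decide (y ≤ ℓ) :=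
    fun y hy => by simp [occ, hV y hy]
  have hgen : ∀ y : ℤ, 1 ≤ y → y ≤ n → (Step.diagonal, ((n : ℤ), y)) ∉ S →
      siteWeight (vertex20At n t) S ((n : ℤ), y) =
        if y + 1 ≤ ℓ then t else if y ≤ ℓ then turnWeight t else 1 := by
    intro y hy hyn hd
    have hice := h2 n y (mem_grid.2 (by omega))
    simp only [siteWeight, vertex20At, columnParam, if_true]
    rw [occ_of_notMem (hE y), occ_of_notMem hd] at hice ⊢
    rw [vertex20_east_empty ht (by simpa using hice), hV' y hy, hV' (y + 1) (by omega)]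
    simp
  cases bc
  · have hdiag : (Step.diagonal, ((n : ℤ), 1)) ∈ S := h3.2.2.2
    have hsplit : Icc (1 : ℤ) n = insert 1 (Icc (2 : ℤ) n) := by
      ext y
      simp only [mem_Icc, mem_insert]
      omega
    rw [hsplit, prod_insert (by simp)]
    have hfirst : siteWeight (vertex20At n t) S ((n : ℤ), 1) =
        if 2 ≤ ℓ then (1 + t) / 2 else turnWeight t := by
      have hice := h2 n 1 (mem_grid.2 (by omega))
      have o1 : occ S (Step.diagonal, ((n : ℤ), 1)) = true := by simp [occ, hdiag]
      have o2 : occ S (Step.vertical, ((n : ℤ), 1)) = true := by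
        rw [hV' 1 le_rfl]
        simpa using hℓ
      simp only [siteWeight, vertex20At, columnParam, if_true]
      rw [occ_of_notMem (hE 1), o1, o2] at hice ⊢
      rw [vertex20_corner ht (by simpa using hice), hV' (1 + 1) (by omega)]
      have : ((1 : ℤ) + 1 ≤ ℓ) ↔ 2 ≤ ℓ := by omega
      simp only [this, decide_eq_true_eq]
    rw [hfirst]
    -- Row 1 is special because of the occupied corner edge: for ℓ ≥ 2 it gives (1 + t) / 2, rows 2
    -- to ℓ - 1 give t each, and row ℓ gives `turnWeight t`. For ℓ = 1 the arrival takes place in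
    -- row 1 itself.
    by_cases hℓ2 : 2 ≤ ℓ
    · have := prod_Icc_int (f := fun y => siteWeight (vertex20At n t) S ((n : ℤ), y)) (a := t)
        (c := turnWeight t) hℓ2 hℓn
        (fun y hy hyl => by
          push_cast at hy
          rw [hgen y (by omega) (by omega) (hD y hy), if_pos (by omega)])
        (by rw [hgen ℓ (by omega) (by omega) (hD ℓ (by omega)), if_neg (by omega),
              if_pos le_rfl])
        (fun y hy hyn => by
          rw [hgen y (by omega) (by omega) (hD y (by omega)), if_neg (by omega),
            if_neg (by omega)])
      push_cast at this
      rw [this, if_pos hℓ2, lastColumnWeight, if_neg (by omega)]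
      ring
    · rw [if_neg hℓ2, lastColumnWeight, if_pos (by omega), prod_eq_one, mul_one, one_mul]
      intro y hy
      rw [mem_Icc] at hy
      rw [hgen y (by omega) (by omega) (hD y (by omega)), if_neg (by omega), if_neg (by omega)]
  · have hD1 : ∀ y : ℤ, 1 ≤ y → (Step.diagonal, ((n : ℤ), y)) ∉ S := fun y hy => by
      obtain rfl | hy2 : y = 1 ∨ 2 ≤ y := by omega
      · exact h3.2.2.2
      · exact hD y hy2
    have := prod_Icc_int (f := fun y => siteWeight (vertex20At n t) S ((n : ℤ), y)) (a := t)
      (c := turnWeight t) hℓ hℓn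
      (fun y hy hyl => by
        push_cast at hy
        rw [hgen y hy (by omega) (hD1 y hy), if_pos (by omega)])
      (by rw [hgen ℓ (by omega) (by omega) (hD1 ℓ (by omega)), if_neg (by omega),
            if_pos le_rfl])
      (fun y hy hyn => by
        rw [hgen y (by omega) (by omega) (hD1 y (by omega)), if_neg (by omega),
          if_neg (by omega)])
    push_cast at this
    rw [this, lastColumnWeight]

theorem sum_vertex20 (bc : DWBCType) (hn : 1 ≤ n) {t : ℝ} (ht : 0 < t) :
    ∑ S ∈ boundaryConfigs bc n, ∏ v ∈ grid n, siteWeight (vertex20At n t) S v =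
      (∑ ℓ ∈ Icc 1 n, (Z20V bc n ℓ : ℝ) * lastColumnWeight bc t ℓ) * turnWeight t := by
  classical
  have hsub : configs20V bc n ⊆ boundaryConfigs bc n := by
    intro S hS
    rw [mem_configs20V] at hS
    simp only [boundaryConfigs, mem_filter, mem_powerset]
    exact ⟨hS.1, hS.2.2⟩
  -- Configurations that violate the ice rule at some vertex have weight 0.
  rw [← sum_subset hsub]
  · rw [sum_eq_sum_hits hn (fun S hS => pathSystem_of_mem_configs20V hS) (topStart n bc)
      (by cases bc <;> simp [topStart, upperLeftCorner, upperWestEdge, tail])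
      (fun S hS => isTop_topStart hn hS), sum_mul]
    refine sum_congr rfl fun ℓ _ => ?_
    rw [sum_congr rfl fun S hS =>
      prod_siteWeight_vertex20 hn ht (mem_filter.1 hS).1 (mem_filter.1 hS).2]
    rw [sum_const, nsmul_eq_mul, Z20V, mul_assoc]
  · intro S hS hS'
    simp only [boundaryConfigs, mem_filter, mem_powerset] at hS
    rw [mem_configs20V, iceRule_triangular] at hS'
    push Not at hS'
    by_contra hne
    refine (fun h => hS' hS.1 h hS.2) fun x y hxy => ?_
    by_contra hne'
    exact hne (prod_eq_zero hxy (vertex20_eq_zero _ hne'))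

end Configurations

/-! ### The 6V model as a 20V model with decoupled diagonal lines -/

section SixVertex

variable {n : ℕ} {S : Finset Edge}

/-- The edges of the diagonal lines that carry a path step at their ends. -/
noncomputable def lowerDiagonals (bc : DWBCType) (n : ℕ) : Finset Edge :=
  open Classical in
  (edges triangularSteps n).filter fun e => e.1 = .diagonal ∧ Filled bc n e

theorem mem_lowerDiagonals {bc : DWBCType} {e : Edge} :
    e ∈ lowerDiagonals bc n ↔ e ∈ edges triangularSteps n ∧ e.1 = .diagonal ∧ Filled bc n e := by
  classical
  simp [lowerDiagonals]

theorem diagonal_notMem_configs6V (hS : S ∈ configs6V n) (v : ℤ × ℤ) :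
    (Step.diagonal, v) ∉ S := fun h => by
  simpa [squareSteps] using (mem_edges_iff.1 ((mem_configs6V.1 hS).1 h)).1

theorem diagonal_mem_union_iff {bc : DWBCType} (hS : S ∈ configs6V n) {x y : ℤ}
    (he : (Step.diagonal, (x, y)) ∈ edges triangularSteps n) :
    (Step.diagonal, (x, y)) ∈ S ∪ lowerDiagonals bc n ↔ x + y ≤ cut bc n + 1 := by
  rw [mem_union, mem_lowerDiagonals]
  simp [diagonal_notMem_configs6V hS, he, Filled]

theorem mem_union_lowerDiagonals_iff {bc : DWBCType} {e : Edge} (he : e.1 ≠ .diagonal) :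
    e ∈ S ∪ lowerDiagonals bc n ↔ e ∈ S := by
  rw [mem_union, mem_lowerDiagonals]
  simp [he]

theorem union_lowerDiagonals_mem {bc : DWBCType} (hn : 1 ≤ n) (hS : S ∈ configs6V n) :
    S ∪ lowerDiagonals bc n ∈ boundaryConfigs bc n := by
  classical
  obtain ⟨h1, -, h3⟩ := mem_configs6V.1 hS
  have hcut : cut bc n ≤ n ∧ n ≤ cut bc n + 1 := by cases bc <;> simp only [cut] <;> omega
  simp only [boundaryConfigs, mem_filter, mem_powerset]
  refine ⟨union_subset (fun e he => (mem_edges_iff.1 (h1 he)).2)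
    fun e he => (mem_lowerDiagonals.1 he).1, ⟨?_, ?_, ?_, ?_⟩, ⟨?_, ?_, ?_, ?_⟩, ?_⟩
  · exact fun y hy => (mem_union_lowerDiagonals_iff (by simp)).2 (h3.1 y hy)
  · exact fun y hy => (mem_union_lowerDiagonals_iff (by simp)).2 (h3.2.1 y hy)
  · exact fun y hy h => h3.2.2.1 y hy ((mem_union_lowerDiagonals_iff (by simp)).1 h)
  · exact fun y hy h => h3.2.2.2 y hy ((mem_union_lowerDiagonals_iff (by simp)).1 h)
  · intro y hy
    rw [mem_Icc] at hy
    rw [diagonal_mem_union_iff hS (mem_edges_diagonal.2 (by omega))]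
    omega
  · intro y hy
    rw [mem_Icc] at hy
    rw [diagonal_mem_union_iff hS (mem_edges_diagonal.2 (by omega))]
    omega
  · intro y hy
    rw [mem_Icc] at hy
    rw [diagonal_mem_union_iff hS (mem_edges_diagonal.2 (by omega))]
    omega
  · intro y hy
    rw [mem_Icc] at hy
    rw [diagonal_mem_union_iff hS (mem_edges_diagonal.2 (by omega))]
    omega
  · have e1 : upperLeftCorner n ∈ S ∪ lowerDiagonals bc n ↔ _ :=
      diagonal_mem_union_iff hS (mem_edges_diagonal.2 (by omega))
    have e2 : lowerRightCorner n ∈ S ∪ lowerDiagonals bc n ↔ _ :=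
      diagonal_mem_union_iff hS (mem_edges_diagonal.2 (by omega))
    cases bc <;> simp only [CornerDWBC, e1, e2, cut] <;> omega

theorem crossHV_eq_zero (t : ℝ) {w s n' e : Bool} (h : w.toNat + n'.toNat ≠ e.toNat + s.toNat) :
    crossHV t w s n' e = 0 := by
  revert h
  cases w <;> cases s <;> cases n' <;> cases e <;> simp [crossHV, crossing]

/-- The 6V weight of a configuration with the given spectral parameters. -/
theorem siteWeight_vertex6 (bc : DWBCType) (t : ℝ) (hS : S ∈ configs6V n) {x y : ℤ}
    (hv : (x, y) ∈ grid n) :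
    siteWeight (vertex6At n t) (S ∪ lowerDiagonals bc n) (x, y) =
      crossHV (columnParam n t x) (occ S (Step.horizontal, (x - 1, y)))
        (occ S (Step.vertical, (x, y))) (occ S (Step.vertical, (x, y + 1)))
        (occ S (Step.horizontal, (x, y))) := by
  have hg := mem_grid.1 hv
  have h1 : ∀ {s : Step} {u : ℤ × ℤ}, s ≠ .diagonal →
      occ (S ∪ lowerDiagonals bc n) (s, u) = occ S (s, u) := fun hs =>
    occ_eq_occ.2 (mem_union_lowerDiagonals_iff hs)
  have h2 : occ (S ∪ lowerDiagonals bc n) (Step.diagonal, (x - 1, y + 1)) =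
      occ (S ∪ lowerDiagonals bc n) (Step.diagonal, (x, y)) := by
    rw [occ, occ, decide_eq_decide, diagonal_mem_union_iff hS (mem_edges_diagonal.2 (by omega)),
      diagonal_mem_union_iff hS (mem_edges_diagonal.2 (by omega)), sub_add_add_cancel]
  simp only [siteWeight, vertex6At, h2]
  rw [h1 (by simp), h1 (by simp), h1 (by simp), h1 (by simp)]
  simp

/-- The 6V model as a 20V model with diagonal lines that do not interact. -/
theorem sum_vertex6_eq (bc : DWBCType) (hn : 1 ≤ n) (t : ℝ) :
    ∑ S ∈ boundaryConfigs bc n, ∏ v ∈ grid n, siteWeight (vertex6At n t) S v =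
      ∑ S ∈ configs6V n, ∏ v ∈ grid n, siteWeight (vertex6At n t) (S ∪ lowerDiagonals bc n) v := by
  classical
  symm
  -- With identity transfer matrices a nonzero weight forces each diagonal line to keep the state of
  -- its ends. So the configurations of nonzero weight arise from 6V configurations by adding the
  -- occupied lines in full.
  refine sum_of_injOn (fun S => S ∪ lowerDiagonals bc n) ?_
    (fun S hS => union_lowerDiagonals_mem hn hS) ?_ fun _ _ => rfl
  · intro S hS T hT hST
    ext ⟨s, v⟩
    by_cases hs : s = .diagonal
    · subst hs
      exact iff_of_false (diagonal_notMem_configs6V hS v) (diagonal_notMem_configs6V hT v)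
    · have := congr_arg (fun U : Finset Edge => (s, v) ∈ U) hST
      simp only at this
      rwa [mem_union_lowerDiagonals_iff hs, mem_union_lowerDiagonals_iff hs, eq_iff_iff] at this
  · intro S hS hS'
    by_contra hne
    refine hS' ?_
    rw [boundaryConfigs, mem_filter, mem_powerset] at hS
    obtain ⟨h1, h3⟩ := hS
    have hloc : ∀ x y : ℤ, (x, y) ∈ grid n → siteWeight (vertex6At n t) S (x, y) ≠ 0 :=
      fun x y hxy h => hne (prod_eq_zero hxy h)
    have hd : ∀ x y : ℤ, (x, y) ∈ grid n →
        ((Step.diagonal, (x - 1, y + 1)) ∈ S ↔ (Step.diagonal, (x, y)) ∈ S) := by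
      intro x y hxy
      by_contra h
      exact hloc x y hxy (by simp [siteWeight, vertex6At, occ, h])
    have hice : ∀ x y : ℤ, (x, y) ∈ grid n →
        (occ S (Step.horizontal, (x - 1, y))).toNat + (occ S (Step.vertical, (x, y + 1))).toNat =
        (occ S (Step.horizontal, (x, y))).toNat + (occ S (Step.vertical, (x, y))).toNat := by
      intro x y hxy
      by_contra h
      exact hloc x y hxy (by simp [siteWeight, vertex6At, crossHV_eq_zero _ h])
    -- Induction on the column: an edge is on the boundary, or its state is that of the preceding
    -- edge on the same antidiagonal.
    have hdiag : ∀ (k : ℕ) (y : ℤ), (Step.diagonal, ((k : ℤ), y)) ∈ edges triangularSteps n →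
        ((Step.diagonal, ((k : ℤ), y)) ∈ S ↔ (k : ℤ) + y ≤ cut bc n + 1) := by
      intro k
      induction k with
      | zero =>
        intro y hy
        exact (boundaryCondition_iff hn).1 h3 _ hy (by rw [mem_innerEdges_diagonal]; simp)
      | succ k ih =>
        intro y hy
        have hm := mem_edges_diagonal.1 hy
        by_cases hyn : y = n + 1
        · exact (boundaryCondition_iff hn).1 h3 _ hy (by rw [mem_innerEdges_diagonal]; omega)
        · rw [← hd _ _ (mem_grid.2 (by omega)), Nat.cast_succ, add_sub_cancel_right,
            ih _ (mem_edges_diagonal.2 (by omega))]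
          omega
    have hmem : ∀ {s : Step} {v : ℤ × ℤ}, s ≠ .diagonal →
        ((s, v) ∈ S.filter (fun e => e.1 ≠ .diagonal) ↔ (s, v) ∈ S) := fun hs => by
      simp [hs]
    have hocc : ∀ {s : Step} {v : ℤ × ℤ}, s ≠ .diagonal →
        occ (S.filter (fun e => e.1 ≠ .diagonal)) (s, v) = occ S (s, v) := fun hs =>
      occ_eq_occ.2 (hmem hs)
    refine ⟨S.filter fun e => e.1 ≠ .diagonal, mem_coe.2 (mem_configs6V.2 ⟨?_, ?_, ?_⟩), ?_⟩
    · intro e he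
      rw [mem_filter] at he
      rw [mem_edges_iff]
      refine ⟨?_, h1 he.1⟩
      have := he.2
      rw [squareSteps]
      revert this
      cases e.1 <;> simp
    · rw [iceRule_square]
      intro x y hxy
      rw [hocc (by simp), hocc (by simp), hocc (by simp), hocc (by simp)]
      exact hice x y hxy
    · exact ⟨fun y hy => (hmem (by simp)).2 (h3.1.1 y hy),
        fun x hx => (hmem (by simp)).2 (h3.1.2.1 x hx),
        fun y hy h => h3.1.2.2.1 y hy ((hmem (by simp)).1 h),
        fun x hx h => h3.1.2.2.2 x hx ((hmem (by simp)).1 h)⟩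
    · ext ⟨s, x, y⟩
      by_cases hs : s = .diagonal
      · subst hs
        simp only [mem_union, mem_filter, ne_eq, not_true_eq_false, and_false, false_or,
          mem_lowerDiagonals, true_and, Filled]
        constructor
        · rintro ⟨he, hf⟩
          have := mem_edges_diagonal.1 he
          lift x to ℕ using this.2.1
          exact (hdiag x y he).2 hf
        · intro he
          have := mem_edges_diagonal.1 (h1 he)
          lift x to ℕ using this.2.1
          exact ⟨h1 he, (hdiag x y (h1 he)).1 he⟩
      · exact (mem_union_lowerDiagonals_iff hs).trans (hmem hs)

theorem crossHV_one {w s n' e : Bool} (h : w.toNat + n'.toNat = e.toNat + s.toNat) :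
    crossHV 1 w s n' e = if w = n' then 1 else if w = e then √2 else 1 := by
  have h2 : √2 ≠ 0 := by positivity
  have h3 : √2 * √2 = 2 := Real.mul_self_sqrt (by norm_num)
  have e1 : (1 + 1) / √2 = √2 := by field_simp; linarith
  revert h
  cases w <;> cases s <;> cases n' <;> cases e <;> simp [crossHV, crossing, e1, turnWeight_one]

/-- The first factor is the homogeneous weight, the second the correction due to t. A vertical
passage has weight (1 + t) / √2 = √2 · (1 + t) / 2, which is the source of the argument (1 + τ) / 2.
-/
theorem crossHV_east_empty (t : ℝ) {w s n' : Bool} (h : w.toNat + n'.toNat = s.toNat) :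
    crossHV t w s n' false = (if w = n' then 1 else if w = false then √2 else 1) *
      if n' then (1 + t) / 2 else if s then turnWeight t else 1 := by
  have h2 : √2 ≠ 0 := by positivity
  have h3 : √2 * √2 = 2 := Real.mul_self_sqrt (by norm_num)
  have e1 : (1 + t) / √2 = √2 * ((1 + t) / 2) := by
    rw [div_eq_iff h2, mul_right_comm, h3]
    ring
  revert h
  cases w <;> cases s <;> cases n' <;> simp [crossHV, crossing, e1]

theorem prod_siteWeight_vertex6 (bc : DWBCType) (hn : 1 ≤ n) (t : ℝ) (hS : S ∈ configs6V n) {ℓ : ℕ}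
    (h : FirstHitsLastColumnAt n S (upperWestEdge n) ℓ) :
    ∏ v ∈ grid n, siteWeight (vertex6At n t) (S ∪ lowerDiagonals bc n) v =
      (∏ v ∈ grid n, weight6V 1 (√2) 1 S v) * ((1 + t) / 2) ^ (ℓ - 1) * turnWeight t := by
  have hP := pathSystem_of_mem_configs6V hS
  have hT := isTop_upperWestEdge hn hS
  obtain ⟨h1, h2, h3⟩ := mem_configs6V.1 hS
  rw [iceRule_square] at h2
  obtain ⟨⟨hℓ, hℓn⟩, -⟩ := h.enter hP hT
  have hE : ∀ y : ℤ, (Step.horizontal, ((n : ℤ), y)) ∉ S := fun y hy =>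
    h3.2.2.1 y (by have := mem_edges_horizontal.1 (hP.subset hy); rw [mem_Icc]; omega) hy
  have hV := occ_vertical_last hP hT hE (fun y _ => diagonal_notMem_configs6V hS _) h
  have hV' : ∀ y : ℤ, 1 ≤ y → occ S (Step.vertical, ((n : ℤ), y)) = decide (y ≤ ℓ) :=
    fun y hy => by simp [occ, hV y hy]
  have hw : ∀ x y : ℤ, weight6V 1 (√2) 1 S (x, y) =
      if occ S (Step.horizontal, (x - 1, y)) = occ S (Step.vertical, (x, y + 1)) then 1
      else if occ S (Step.horizontal, (x - 1, y)) = occ S (Step.horizontal, (x, y)) then √2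
      else 1 := by
    intro x y
    simp only [weight6V, occ, decide_eq_decide, Prod.mk_sub_mk, Prod.mk_add_mk, sub_zero, add_zero]
  -- The ratio of the inhomogeneous to the homogeneous weight, which differs from 1 only in the last
  -- column.
  let r : ℤ × ℤ → ℝ := fun v => if v.1 = n then
    (if v.2 + 1 ≤ ℓ then (1 + t) / 2 else if v.2 ≤ ℓ then turnWeight t else 1) else 1
  have hr : ∀ v ∈ grid n, siteWeight (vertex6At n t) (S ∪ lowerDiagonals bc n) v =
      weight6V 1 (√2) 1 S v * r v := by
    rintro ⟨x, y⟩ hv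
    have hg := mem_grid.1 hv
    have hice := h2 x y hv
    rw [siteWeight_vertex6 bc t hS hv, hw]
    by_cases hx : x = n
    · subst hx
      rw [occ_of_notMem (hE y)] at hice ⊢
      simp only [columnParam, if_true, r]
      rw [crossHV_east_empty t (by simpa using hice), hV' y (by omega), hV' (y + 1) (by omega)]
      simp only [decide_eq_true_eq]
    · simp only [columnParam, if_neg hx, r, mul_one]
      exact crossHV_one hice
  rw [prod_congr rfl hr, prod_mul_distrib, mul_assoc,
    prod_grid_eq_prod_last_column hn (f := r) (fun x y _ hx => if_neg hx)]
  congr 1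
  have := prod_Icc_int (f := fun y => r ((n : ℤ), y)) (a := (1 + t) / 2) (c := turnWeight t) hℓ hℓn
    (fun y hy hyl => by simp only [r, if_true]; rw [if_pos (by omega)])
    (by simp only [r, if_true]; rw [if_neg (by omega), if_pos le_rfl])
    (fun y hy hyn => by simp only [r, if_true]; rw [if_neg (by omega), if_neg (by omega)])
  push_cast at this
  exact this

theorem sum_vertex6 (bc : DWBCType) (hn : 1 ≤ n) (t : ℝ) :
    ∑ S ∈ boundaryConfigs bc n, ∏ v ∈ grid n, siteWeight (vertex6At n t) S v =
      (∑ ℓ ∈ Icc 1 n, Z6V 1 (√2) 1 n ℓ * ((1 + t) / 2) ^ (ℓ - 1)) * turnWeight t := by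
  classical
  rw [sum_vertex6_eq bc hn, sum_eq_sum_hits hn (fun S hS => pathSystem_of_mem_configs6V hS)
    (upperWestEdge n) (by simp [upperWestEdge, tail]) (fun S hS => isTop_upperWestEdge hn hS),
    sum_mul]
  refine sum_congr rfl fun ℓ _ => ?_
  rw [sum_congr rfl fun S hS =>
    prod_siteWeight_vertex6 bc hn t (mem_filter.1 hS).1 (mem_filter.1 hS).2]
  rw [Z6V, sum_mul, sum_mul]

/-- The refined numbers of the 20V model in terms of those of the 6V model. -/
theorem sum_Z20V_eq_sum_Z6V (bc : DWBCType) (hn : 1 ≤ n) {t : ℝ} (ht : 0 < t) :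
    ∑ ℓ ∈ Icc 1 n, (Z20V bc n ℓ : ℝ) * lastColumnWeight bc t ℓ =
      ∑ ℓ ∈ Icc 1 n, Z6V 1 (√2) 1 n ℓ * ((1 + t) / 2) ^ (ℓ - 1) := by
  -- On both sides the uppermost path contributes one factor `turnWeight t` on arrival in the last
  -- column; it is positive and cancels, leaving polynomials in t.
  refine mul_right_cancel₀ (turnWeight_pos t).ne' ?_
  rw [← sum_vertex20 bc hn ht, ← sum_vertex6 bc hn, sum_vertex20_eq_sum_vertex6 bc hn ht]

end SixVertex

/-! ### Generating polynomials and their coefficients -/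

section Polynomials

open Polynomial

/-- The polynomial `∑_{ℓ=d}^n a_ℓ X^{ℓ-d}`. -/
noncomputable def shiftedPoly (d n : ℕ) (a : ℕ → ℝ) : ℝ[X] :=
  ∑ ℓ ∈ Icc d n, C (a ℓ) * X ^ (ℓ - d)

theorem coeff_shiftedPoly {d n ℓ : ℕ} (a : ℕ → ℝ) (hd : d ≤ ℓ) (hn : ℓ ≤ n) :
    (shiftedPoly d n a).coeff (ℓ - d) = a ℓ := by
  rw [shiftedPoly, finsetSum_coeff, sum_eq_single ℓ]
  · rw [coeff_C_mul_X_pow, if_pos rfl]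
  · intro m hm hne
    rw [mem_Icc] at hm
    rw [coeff_C_mul_X_pow, if_neg (by omega)]
  · intro h
    exact absurd (mem_Icc.2 ⟨hd, hn⟩) h

theorem shiftedPoly_succ {d n : ℕ} (a : ℕ → ℝ) (hn : d ≤ n) :
    shiftedPoly d n a = C (a d) + X * shiftedPoly (d + 1) n a := by
  rw [shiftedPoly, ← insert_Icc_add_one_left_eq_Icc hn, sum_insert (by simp), shiftedPoly, mul_sum]
  congr 1
  · simp
  · refine sum_congr rfl fun m hm => ?_
    rw [mem_Icc] at hm
    rw [mul_left_comm, ← pow_succ']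
    congr 2
    omega

theorem coeff_shiftedPoly_comp {d n j : ℕ} (a : ℕ → ℝ) :
    ((shiftedPoly d n a).comp (C (1 / 2) * (1 + X))).coeff j =
      ∑ m ∈ Icc d n, (Nat.choose (m - d) j : ℝ) * (1 / 2 ^ (m - d)) * a m := by
  rw [shiftedPoly, ← coe_compRingHom_apply, map_sum, finsetSum_coeff]
  refine sum_congr rfl fun m _ => ?_
  rw [coe_compRingHom_apply, mul_comp, C_comp, pow_comp, X_comp, mul_pow, ← C_pow, coeff_C_mul, coeff_C_mul,
    coeff_one_add_X_pow, one_div_pow]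
  ring

theorem eq_sum_choose_of_comp {d n : ℕ} {a b : ℕ → ℝ}
    (h : shiftedPoly d n a = (shiftedPoly d n b).comp (C (1 / 2) * (1 + X))) {ℓ : ℕ} (hd : d ≤ ℓ)
    (hn : ℓ ≤ n) :
    a ℓ = ∑ m ∈ Icc ℓ n, (Nat.choose (m - d) (ℓ - d) : ℝ) * (1 / 2 ^ (m - d)) * b m := by
  rw [← coeff_shiftedPoly a hd hn, h, coeff_shiftedPoly_comp]
  symm
  -- The terms with m < ℓ have a vanishing binomial coefficient.
  refine sum_subset (Icc_subset_Icc_left hd) fun m hm hm' => ?_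
  rw [mem_Icc] at hm hm'
  rw [Nat.choose_eq_zero_of_lt (by omega)]
  simp

theorem eq_of_eval_pos {p q : ℝ[X]} (h : ∀ t : ℝ, 0 < t → p.eval t = q.eval t) : p = q :=
  eq_of_infinite_eval_eq p q ((Set.Ioi_infinite (0 : ℝ)).mono fun t ht => h t ht)

theorem eval_shiftedPoly (d n : ℕ) (a : ℕ → ℝ) (t : ℝ) :
    (shiftedPoly d n a).eval t = ∑ ℓ ∈ Icc d n, a ℓ * t ^ (ℓ - d) := by
  simp [shiftedPoly, eval_finsetSum]

variable {n : ℕ}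

theorem genPoly20V_bc2 (hn : 1 ≤ n) :
    genPoly20V .bc2 n = (genPoly6V 1 (√2) 1 n).comp (C (1 / 2) * (1 + X)) := by
  refine eq_of_eval_pos fun t ht => ?_
  have h := sum_Z20V_eq_sum_Z6V .bc2 hn ht
  simp only [lastColumnWeight, ← eval_shiftedPoly] at h
  rw [eval_comp, show eval t (C (1 / 2) * (1 + X)) = (1 + t) / 2 by simp; ring]
  exact h

/-- For ℓ ≥ 2 both sides of the comparison carry the factor (1 + t) / 2, for ℓ = 1 neither does. The
two parts can therefore be separated. -/
theorem shiftedPoly_bc1 (hn : 1 ≤ n) :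
    (Z20V .bc1 n 1 : ℝ) = Z6V 1 (√2) 1 n 1 ∧ shiftedPoly 2 n (fun ℓ => (Z20V .bc1 n ℓ : ℝ)) =
      (shiftedPoly 2 n fun m => Z6V 1 (√2) 1 n m).comp (C (1 / 2) * (1 + X)) := by
  have key : C (Z20V .bc1 n 1 : ℝ) +
      C (1 / 2) * (1 + X) * shiftedPoly 2 n (fun ℓ => (Z20V .bc1 n ℓ : ℝ)) =
      (genPoly6V 1 (√2) 1 n).comp (C (1 / 2) * (1 + X)) := by
    refine eq_of_eval_pos fun t ht => ?_
    have h := sum_Z20V_eq_sum_Z6V .bc1 hn ht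
    rw [← insert_Icc_add_one_left_eq_Icc hn, sum_insert (by simp),
      insert_Icc_add_one_left_eq_Icc hn, lastColumnWeight, if_pos rfl, mul_one,
      ← eval_shiftedPoly] at h
    rw [eval_comp, show eval t (C (1 / 2) * (1 + X)) = (1 + t) / 2 by simp; ring]
    refine Eq.trans ?_ h
    rw [eval_add, eval_C, eval_mul, eval_shiftedPoly,
      show eval t (C (1 / 2) * (1 + X)) = (1 + t) / 2 by simp; ring, mul_sum]
    congr 1
    refine sum_congr rfl fun ℓ hℓ => ?_
    rw [mem_Icc] at hℓ
    rw [lastColumnWeight, if_neg (by omega)]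
    ring
  have h6 : genPoly6V 1 (√2) 1 n =
      C (Z6V 1 (√2) 1 n 1) + X * shiftedPoly 2 n fun m => Z6V 1 (√2) 1 n m :=
    shiftedPoly_succ (d := 1) _ hn
  rw [h6, add_comp, C_comp, mul_comp, X_comp] at key
  have h1 : (Z20V .bc1 n 1 : ℝ) = Z6V 1 (√2) 1 n 1 := by
    -- At -1 the factor (1 + X) / 2 vanishes and only the terms with ℓ = 1 survive.
    have := congr_arg (eval (-1)) key
    simpa using this
  refine ⟨h1, ?_⟩
  rw [h1] at key
  refine mul_left_cancel₀ ?_ (add_left_cancel key)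
  intro h0
  have := congr_arg (eval 1) h0
  norm_num at this

end Polynomials

end TwentyVertex

/-! ### The relations between the refined partition functions -/

theorem mainTheorem4 (n : ℕ) (hn : 1 ≤ n) :
    (∀ τ : ℂ,
      Polynomial.aeval τ (TwentyVertex.genPoly20V .bc2 n) =
        Polynomial.aeval ((1 + τ) / 2) (TwentyVertex.genPoly6V 1 (Real.sqrt 2) 1 n)) ∧
    (∀ τ : ℂ, τ ≠ 0 →
      Polynomial.aeval τ (TwentyVertex.genPoly20V .bc2 n) =
        Polynomial.aeval (0 : ℂ) (TwentyVertex.genPoly20V .bc1 n) +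
          (1 + τ) / (2 * τ) *
            (Polynomial.aeval τ (TwentyVertex.genPoly20V .bc1 n) -
              Polynomial.aeval (0 : ℂ) (TwentyVertex.genPoly20V .bc1 n))) ∧
    (TwentyVertex.Z20V .bc1 n 1 : ℝ) = TwentyVertex.Z6V 1 (Real.sqrt 2) 1 n 1 ∧
    (∀ ℓ : ℕ, 2 ≤ ℓ → ℓ ≤ n →
      (TwentyVertex.Z20V .bc1 n ℓ : ℝ) =
        ∑ m ∈ Finset.Icc ℓ n, (Nat.choose (m - 2) (ℓ - 2) : ℝ) * (1 / 2 ^ (m - 2)) *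
          TwentyVertex.Z6V 1 (Real.sqrt 2) 1 n m) ∧
    (∀ ℓ : ℕ, 1 ≤ ℓ → ℓ ≤ n →
      (TwentyVertex.Z20V .bc2 n ℓ : ℝ) =
        ∑ m ∈ Finset.Icc ℓ n, (Nat.choose (m - 1) (ℓ - 1) : ℝ) * (1 / 2 ^ (m - 1)) *
          TwentyVertex.Z6V 1 (Real.sqrt 2) 1 n m) := by
  have h2 := TwentyVertex.genPoly20V_bc2 hn
  obtain ⟨h1, hs⟩ := TwentyVertex.shiftedPoly_bc1 hn
  have hhalf : ∀ τ : ℂ, Polynomial.aeval τ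
      ((Polynomial.C (1 / 2) * (1 + Polynomial.X) : Polynomial ℝ)) = (1 + τ) / 2 := by
    intro τ
    rw [map_mul, Polynomial.aeval_C, map_add, map_one, Polynomial.aeval_X, Complex.coe_algebraMap]
    push_cast
    ring
  refine ⟨fun τ => ?_, fun τ hτ => ?_, h1,
    fun ℓ hℓ hℓn => TwentyVertex.eq_sum_choose_of_comp hs hℓ hℓn,
    fun ℓ hℓ hℓn => TwentyVertex.eq_sum_choose_of_comp h2 hℓ hℓn⟩
  · rw [h2, Polynomial.aeval_comp, hhalf]
  · have e1 : TwentyVertex.genPoly20V .bc1 n = _ := TwentyVertex.shiftedPoly_succ (d := 1) _ hn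
    have e6 : TwentyVertex.genPoly6V 1 (Real.sqrt 2) 1 n = _ :=
      TwentyVertex.shiftedPoly_succ (d := 1) _ hn
    rw [h2, e6, e1, Polynomial.aeval_comp, hhalf]
    -- With q the shifted 6V polynomial from ℓ = 2 on, both sides equal the ℓ = 1 term plus (1 + τ)
    -- / 2 · q((1 + τ) / 2); on the right the division by τ undoes the factor X split off from the
    -- BC1 polynomial.
    simp only [one_add_one_eq_two, hs, map_add, map_mul, Polynomial.aeval_C, Polynomial.aeval_X,
      Polynomial.aeval_comp, hhalf, h1]
    field_simp
    ring
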